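/- Let $m_1,m_2\ge 1$ and $p_1,p_2\ge 0$ be integers (together with integers $k_1,k_2\ge 0$, where $k_i\geq 1$ unless $p_i=0$, they form the parameter $\gamma=(m,k,p)$ of a hollow lattice diagram; the statement does not involve $k$), and set $n=m_1+p_1+m_2+p_2+1$. Let $\mathcal G_\gamma\subset\mathbb C[X_n,Y_n]=\mathbb C[x_1,\dots,x_n,y_1,\dots,y_n]$ be the ideal generated by the monomials $x_iy_i$ ($1\le i\le n$), $\prod_{i\in D}x_i$ ($D\subset\{1,\dots,n\}$, $|D|=m_1+p_1+1$) and $\prod_{i\in E}y_i$ ($E\subset\{1,\dots,n\}$, $|E|=m_2+p_2+1$). Ferrers diagrams are drawn in the French way, and a standard tableau with $n$ cells is a filling of such a diagram by $1,\dots,n$, each used once, that increases along rows (left to right) and columns (bottom to top). For a standard tableau $T$ with $n$ cells let $\pi_T(1)=0$ and, for $1<i\le n$, $\pi_T(i)=\pi_T(i-1)$ if $i$ lies weakly southeast of $i-1$ in $T$, and $\pi_T(i)=\pi_T(i-1)+1$ if $i$ lies weakly northwest of $i-1$. The cocharge diagram $C_\gamma(T)$ is the filling of the shape of $T$ whose entry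 in the cell of $i$ is $(d,0)$ if $d\ge 0$ and $(0,-d)$ if $d<0$, where $d=\pi_T(i)-\pi_T(m_2+p_2+1)$. For a standard tableau $T$ with $n$ cells and a filling $V$ of the shape of $T$ by pairs of natural numbers, put $$[T,V]_{\mathrm{per}}=\sum_{\sigma}\ \prod_{i=1}^n x_{\sigma(i)}^{a_i}\,y_{\sigma(i)}^{b_i},$$ where $(a_i,b_i)$ is the entry of $V$ in the cell that contains $i$ in $T$, and $\sigma$ runs over the permutations of $\{1,\dots,n\}$ that map each row of $T$ to itself. Let $$\mathcal B_\gamma=\{[T,C_\gamma(U)]_{\mathrm{per}} : T,U \text{ standard tableaux with } n \text{ cells and of the same shape}\},$$ and for $b=[T,V]_{\mathrm{per}}\in\mathcal B_\gamma$ let $|X(b)|=\sum_i a_i$ and $|Y(b)|=\sum_i b_i$, which are the degrees of $b$ in the variables $x$ and in the variables $y$. Then the bigraded Hilbert series $\sum_{r,s\ge 0}\dim_{\mathbb C}\bigl((\mathbb C[X_n,Y_n]/\mathcal G_\gamma)_{r,s}\bigr)\,t^rq^s$, where $(\cdot)_{r,s}$ denotes the component of total degree $r$ in the $x_i$ and total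 degree $s$ in the $y_i$, equals $$\frac{1}{(t)_{m_1+p_1}\,(q)_{m_2+p_2}}\sum_{b\in\mathcal B_\gamma}t^{|X(b)|}q^{|Y(b)|},$$ where $(z)_j=(1-z)(1-z^2)\cdots(1-z^j)$. -/

import Mathlib

open MvPolynomial

/-- Parameters `γ = (m, k, p)` of a hollow lattice diagram: `mᵢ ≥ 1`, `pᵢ ≥ 0`, and `kᵢ ≥ 1`,
where `kᵢ = 0` is also allowed if `pᵢ = 0`. -/
structure HollowParam where
  m₁ : ℕ
  m₂ : ℕ
  k₁ : ℕ
  k₂ : ℕ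
  p₁ : ℕ
  p₂ : ℕ
  hm₁ : 1 ≤ m₁
  hm₂ : 1 ≤ m₂
  hk₁ : 1 ≤ k₁ ∨ p₁ = 0
  hk₂ : 1 ≤ k₂ ∨ p₂ = 0

/-- The number of cells of the hollow lattice diagram. -/
abbrev HollowParam.n (γ : HollowParam) : ℕ := γ.m₁ + γ.p₁ + γ.m₂ + γ.p₂ + 1

/-- `ℂ[Xₙ, Yₙ]`: the variable `Sum.inl i` is `x_{i+1}` and `Sum.inr i` is `y_{i+1}`. -/
abbrev PolyXY (n : ℕ) : Type := MvPolynomial (Fin n ⊕ Fin n) ℂ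

/-- The alphabet `𝒜` of pairs `(a, b)` of naturals with `a = 0` or `b = 0`. -/
def Alphabet : Type := {u : ℕ × ℕ // u.1 = 0 ∨ u.2 = 0}

namespace Alphabet

/-- The signed value `a - b` of a letter `(a, b)`. -/
def toInt (u : Alphabet) : ℤ := (u.1.1 : ℤ) - u.1.2

/-- `z ≥ 0` names the letter `(z, 0)` and `z < 0` names the letter `(0, -z)`. -/
def ofInt (z : ℤ) : Alphabet := ⟨(z.toNat, (-z).toNat), by omega⟩

theorem toInt_ofInt (z : ℤ) : toInt (ofInt z) = z := by
  simp only [toInt, ofInt]; omega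

theorem ofInt_toInt (u : Alphabet) : ofInt (toInt u) = u := by
  obtain ⟨⟨a, b⟩, h⟩ := u
  apply Subtype.ext
  simp only [toInt, ofInt, Prod.mk.injEq]
  simp only at h
  omega

theorem toInt_injective : Function.Injective toInt :=
  Function.LeftInverse.injective ofInt_toInt

/-- The order of `𝒜`: `(a₁, b₁) < (a₂, b₂)` iff `a₁ - b₁ < a₂ - b₂`
(distinct letters of `𝒜` have distinct differences). -/
noncomputable instance : LinearOrder Alphabet := LinearOrder.lift' toInt toInt_injective

/-- The order on `ℕ × ℕ` by difference, ties being broken by the first entry, restricts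
to the order of `𝒜`. -/
theorem lt_iff (u v : Alphabet) :
    u < v ↔ (u.1.1 : ℤ) - u.1.2 < (v.1.1 : ℤ) - v.1.2 ∨
      ((u.1.1 : ℤ) - u.1.2 = (v.1.1 : ℤ) - v.1.2 ∧ u.1.1 < v.1.1) := by
  have h : u < v ↔ (u.1.1 : ℤ) - u.1.2 < (v.1.1 : ℤ) - v.1.2 := Iff.rfl
  obtain ⟨⟨a, b⟩, hu⟩ := u
  obtain ⟨⟨c, d⟩, hv⟩ := v
  rw [h]
  simp only at hu hv ⊢
  omega

/-- `𝒜` is ordered like the integers. -/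
noncomputable def orderIsoInt : Alphabet ≃o ℤ where
  toFun := toInt
  invFun := ofInt
  left_inv := ofInt_toInt
  right_inv := toInt_ofInt
  map_rel_iff' := Iff.rfl

end Alphabet

/-- The map `h : ℕ → 𝒜` that preserves order and covers and sends `j₀` to `(0, 0)`. -/
def shiftMap (j₀ j : ℕ) : Alphabet := Alphabet.ofInt ((j : ℤ) - j₀)

/-- `shiftMap j₀` is the unique map that preserves order and covers and sends `j₀` to `(0, 0)`. -/
theorem shiftMap_unique (j₀ : ℕ) (h : ℕ → Alphabet) :
    (StrictMono h ∧ (∀ i j, i ⋖ j → h i ⋖ h j) ∧ (h j₀).1 = (0, 0)) ↔ h = shiftMap j₀ := by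
  have key : ∀ u v : Alphabet, u ⋖ v ↔ u.toInt + 1 = v.toInt := fun u v => by
    rw [← apply_covBy_apply_iff Alphabet.orderIsoInt, Order.covBy_iff_add_one_eq]; rfl
  constructor
  · rintro ⟨-, hc, h0⟩
    have h1 : ∀ i, (h i).toInt + 1 = (h (i + 1)).toInt := fun i =>
      (key _ _).1 (hc i (i + 1) (Order.covBy_add_one i))
    have h2 : ∀ i : ℕ, (h i).toInt = (h 0).toInt + i := by
      intro i
      induction i with
      | zero => simp
      | succ i ih => rw [← h1, ih]; push_cast; ring
    have h3 : (h j₀).toInt = 0 := by simp [Alphabet.toInt, h0]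
    funext j
    apply Alphabet.toInt_injective
    rw [shiftMap, Alphabet.toInt_ofInt]
    have := h2 j
    have := h2 j₀
    omega
  · rintro rfl
    refine ⟨fun i j hij => ?_, fun i j hij => ?_, ?_⟩
    · change Alphabet.toInt _ < Alphabet.toInt _
      simp only [shiftMap, Alphabet.toInt_ofInt]; omega
    · rw [key]
      simp only [shiftMap, Alphabet.toInt_ofInt]
      have := Order.covBy_iff_add_one_eq.1 hij
      omega
    · simp [shiftMap, Alphabet.ofInt]

/-- Standard tableaux of shape `μ` with `n` cells.  A cell `(i, j)` of `μ` lies in row `i`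
(counted from the bottom, French style) and column `j`; both are counted from `0`.
The number in the cell `c` is `entry c + 1`. -/
structure StdTableau (μ : YoungDiagram) (n : ℕ) where
  entry : {c // c ∈ μ.cells} ≃ Fin n
  row_lt : ∀ c d : {c // c ∈ μ.cells}, c.1.1 = d.1.1 → c.1.2 < d.1.2 → entry c < entry d
  col_lt : ∀ c d : {c // c ∈ μ.cells}, c.1.2 = d.1.2 → c.1.1 < d.1.1 → entry c < entry d

namespace StdTableau

variable {μ : YoungDiagram} {n : ℕ}

/-- The row, counted from the bottom, of the number `i + 1`. -/
def row (T : StdTableau μ n) (i : Fin n) : ℕ := (T.entry.symm i).1.1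

/-- The column of the number `i + 1`. -/
def col (T : StdTableau μ n) (i : Fin n) : ℕ := (T.entry.symm i).1.2

/-- The cocharge map `π`, at the number `i + 1`: it starts with `0`, keeps its value where the
next number is weakly southeast of the previous one, and grows by `1` otherwise (in a standard
tableau the next number is then weakly northwest of the previous one). -/
def cocharge (T : StdTableau μ n) : (i : ℕ) → i < n → ℕ
  | 0, _ => 0
  | i + 1, h =>
    if T.row ⟨i + 1, h⟩ ≤ T.row ⟨i, by omega⟩ ∧ T.col ⟨i, by omega⟩ ≤ T.col ⟨i + 1, h⟩ then
      cocharge T i (by omega)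
    else
      cocharge T i (by omega) + 1

/-- The row group `R(T)`: the permutations that map each row of `T` to itself. -/
def rowGroup (T : StdTableau μ n) : Finset (Equiv.Perm (Fin n)) :=
  Finset.univ.filter fun σ => ∀ i, T.row (σ i) = T.row i

/-- The bipermanent `[T, U]_per = ∑_{σ ∈ R(T)} ∏ᵢ z_{σ(i)}^{uᵢ}`, where `uᵢ` is the letter of `U`
in the cell that holds `i` in `T`, and `z_j^{(a, b)} = x_j^a y_j^b`. -/
noncomputable def bipermanent (T : StdTableau μ n) (U : {c // c ∈ μ.cells} → Alphabet) :
    PolyXY n :=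
  ∑ σ ∈ T.rowGroup, ∏ i : Fin n,
    (X (Sum.inl (σ i)) ^ (U (T.entry.symm i)).1.1 * X (Sum.inr (σ i)) ^ (U (T.entry.symm i)).1.2)

end StdTableau

/-- The cocharge diagram of a standard tableau `T`: the filling `h_γ ∘ π ∘ T`, where `h_γ` sends
the cocharge of the number `m₂ + p₂ + 1` to `(0, 0)`. -/
def cochargeDiagram (γ : HollowParam) {μ : YoungDiagram} (T : StdTableau μ γ.n) :
    {c // c ∈ μ.cells} → Alphabet := fun c =>
  shiftMap (T.cocharge (γ.m₂ + γ.p₂) (by unfold HollowParam.n; omega))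
    (T.cocharge (T.entry c) (T.entry c).isLt)

/-- The set `ℬ_γ` of all bipermanents `[T, V]_per`, where `T` is a standard tableau with `n` cells
and `V` is the cocharge diagram of a standard tableau of the same shape. -/
def hollowB (γ : HollowParam) : Set (PolyXY γ.n) :=
  {b | ∃ (μ : YoungDiagram) (T : StdTableau μ γ.n), ∃ V ∈ Set.range (cochargeDiagram γ (μ := μ)),
    b = T.bipermanent V}

/-- `|X(b)|`, the degree of `b` in the variables `x`. -/
noncomputable def xDeg {n : ℕ} (b : PolyXY n) : ℕ :=
  b.weightedTotalDegree (Sum.elim (fun _ => 1) (fun _ => 0))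

/-- `|Y(b)|`, the degree of `b` in the variables `y`. -/
noncomputable def yDeg {n : ℕ} (b : PolyXY n) : ℕ :=
  b.weightedTotalDegree (Sum.elim (fun _ => 0) (fun _ => 1))

section Degree

variable {μ : YoungDiagram} {n : ℕ}

theorem StdTableau.weightedTotalDegree_bipermanent (T : StdTableau μ n)
    (U : {c // c ∈ μ.cells} → Alphabet) (a b : ℕ) :
    (T.bipermanent U).weightedTotalDegree (Sum.elim (fun _ => a) (fun _ => b)) =
      ∑ c, ((U c).1.1 * a + (U c).1.2 * b) := by
  classical
  set w : Fin n ⊕ Fin n → ℕ := Sum.elim (fun _ => a) (fun _ => b) with hw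
  have hhom : IsWeightedHomogeneous w (T.bipermanent U)
      (∑ c, ((U c).1.1 * a + (U c).1.2 * b)) := by
    rw [StdTableau.bipermanent]
    apply IsWeightedHomogeneous.sum
    intro σ _
    rw [← Equiv.sum_comp T.entry.symm]
    apply IsWeightedHomogeneous.prod
    intro i _
    have h1 := (isWeightedHomogeneous_X ℂ w (Sum.inl (σ i))).pow (U (T.entry.symm i)).1.1
    have h2 := (isWeightedHomogeneous_X ℂ w (Sum.inr (σ i))).pow (U (T.entry.symm i)).1.2
    simpa [hw] using h1.mul h2
  have hne : T.bipermanent U ≠ 0 := by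
    intro h0
    have h1 := congrArg (MvPolynomial.eval (fun _ => (1 : ℂ))) h0
    simp only [StdTableau.bipermanent, map_sum, map_prod, map_mul, map_pow, eval_X, one_pow,
      mul_one, Finset.prod_const_one, Finset.sum_const, map_zero, nsmul_eq_mul,
      Nat.cast_eq_zero, Finset.card_eq_zero] at h1
    have : (1 : Equiv.Perm (Fin n)) ∈ T.rowGroup := by simp [StdTableau.rowGroup]
    simp [h1] at this
  have := hhom.weighted_total_degree hne
  rw [weightedTotalDegree_coe w _ hne] at this
  exact_mod_cast this

/-- For a bipermanent `b = [T, V]_per`, `|X(b)|` is the sum of the first entries of `V`. -/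
theorem xDeg_bipermanent (T : StdTableau μ n) (U : {c // c ∈ μ.cells} → Alphabet) :
    xDeg (T.bipermanent U) = ∑ c, (U c).1.1 := by
  simpa [xDeg, yDeg] using T.weightedTotalDegree_bipermanent U 1 0

/-- For a bipermanent `b = [T, V]_per`, `|Y(b)|` is the sum of the second entries of `V`. -/
theorem yDeg_bipermanent (T : StdTableau μ n) (U : {c // c ∈ μ.cells} → Alphabet) :
    yDeg (T.bipermanent U) = ∑ c, (U c).1.2 := by
  simpa [xDeg, yDeg] using T.weightedTotalDegree_bipermanent U 0 1

end Degree

instance (μ : YoungDiagram) (n : ℕ) : Finite (StdTableau μ n) :=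
  Finite.of_injective (fun T : StdTableau μ n => T.entry) (by
    rintro ⟨e, _, _⟩ ⟨f, _, _⟩ h
    simpa using h)

theorem finite_shapes (n : ℕ) : {μ : YoungDiagram | Nonempty (StdTableau μ n)}.Finite := by
  classical
  refine Set.Finite.of_finite_image (f := YoungDiagram.cells)
    (Set.Finite.subset (Finset.finite_toSet (Finset.range n ×ˢ Finset.range n).powerset) ?_)
    (fun μ _ ν _ h => YoungDiagram.ext h)
  rintro _ ⟨μ, ⟨T⟩, rfl⟩
  have hcard : μ.cells.card = n := by
    simpa using Fintype.card_congr T.entry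
  simp only [Finset.coe_powerset, Set.mem_preimage, Set.mem_powerset_iff]
  rintro ⟨i, j⟩ hij
  have hij' : (i, j) ∈ μ := (YoungDiagram.mem_cells _).1 hij
  have h1 : ((Finset.range (i + 1)).image fun a => (a, 0)) ⊆ μ.cells := by
    intro c hc
    obtain ⟨a, ha, rfl⟩ := Finset.mem_image.1 hc
    exact (YoungDiagram.mem_cells _).2
      (μ.up_left_mem (by have := Finset.mem_range.1 ha; omega) (Nat.zero_le _) hij')
  have h2 : ((Finset.range (j + 1)).image fun a => (0, a)) ⊆ μ.cells := by
    intro c hc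
    obtain ⟨a, ha, rfl⟩ := Finset.mem_image.1 hc
    exact (YoungDiagram.mem_cells _).2
      (μ.up_left_mem (Nat.zero_le _) (by have := Finset.mem_range.1 ha; omega) hij')
  have h1' := Finset.card_le_card h1
  have h2' := Finset.card_le_card h2
  rw [Finset.card_image_of_injective _ (fun a b h => by simpa using h), Finset.card_range,
    hcard] at h1' h2'
  simp only [Finset.coe_product, Finset.coe_range, Set.mem_prod, Set.mem_Iio]
  omega

theorem hollowB_finite (γ : HollowParam) : (hollowB γ).Finite := by
  refine Set.Finite.subset ((finite_shapes γ.n).biUnion (t := fun μ =>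
    Set.range fun q : StdTableau μ γ.n × StdTableau μ γ.n =>
      q.1.bipermanent (cochargeDiagram γ q.2)) fun μ _ => Set.finite_range _) ?_
  rintro _ ⟨μ, T, _, ⟨U, rfl⟩, rfl⟩
  exact Set.mem_biUnion (x := μ) ⟨T⟩ ⟨(T, U), rfl⟩

/-- The monomial ideal `𝒢_γ`, generated by the `xᵢyᵢ`, by the products of `m₁ + p₁ + 1` distinct
variables `xᵢ`, and by the products of `m₂ + p₂ + 1` distinct variables `yᵢ`. -/
noncomputable def hollowG (γ : HollowParam) : Ideal (PolyXY γ.n) :=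
  Ideal.span
    (Set.range (fun i : Fin γ.n => (X (Sum.inl i) * X (Sum.inr i) : PolyXY γ.n)) ∪
      {f | ∃ D : Finset (Fin γ.n), D.card = γ.m₁ + γ.p₁ + 1 ∧ f = ∏ i ∈ D, X (Sum.inl i)} ∪
      {f | ∃ E : Finset (Fin γ.n), E.card = γ.m₂ + γ.p₂ + 1 ∧ f = ∏ i ∈ E, X (Sum.inr i)})

/-- The bihomogeneous polynomials of total degree `r` in the `x` and total degree `s` in the `y`. -/
noncomputable def bihomogeneous (n r s : ℕ) : Submodule ℂ (PolyXY n) :=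
  weightedHomogeneousSubmodule ℂ
    (Sum.elim (fun _ => ((1, 0) : ℕ × ℕ)) (fun _ => ((0, 1) : ℕ × ℕ))) (r, s)

/-- The component of bidegree `(r, s)` of `ℂ[Xₙ, Yₙ] / I`: the image of the bihomogeneous
polynomials of bidegree `(r, s)`. -/
noncomputable def quotientComponent {n : ℕ} (I : Ideal (PolyXY n)) (r s : ℕ) :
    Submodule ℂ (PolyXY n ⧸ I) :=
  (bihomogeneous n r s).map (Ideal.Quotient.mkₐ ℂ I).toLinearMap

/-- The bigraded Hilbert series of `ℂ[Xₙ, Yₙ] / I`, a formal power series in two variables `t`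
(of index `0`) and `q` (of index `1`): the coefficient of `t^r q^s` is the dimension of the
component of bidegree `(r, s)`. -/
noncomputable def hilbertSeries {n : ℕ} (I : Ideal (PolyXY n)) : MvPowerSeries (Fin 2) ℚ :=
  fun d => (Module.finrank ℂ (quotientComponent I (d 0) (d 1)) : ℚ)

/-- `(z)_j = (1 - z)(1 - z²) ⋯ (1 - z^j)`. -/
noncomputable def risingProd (z : MvPowerSeries (Fin 2) ℚ) (j : ℕ) : MvPowerSeries (Fin 2) ℚ :=
  ∏ i ∈ Finset.range j, (1 - z ^ (i + 1))

/-!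
Write `N₁ = m₁ + p₁` and `N₂ = m₂ + p₂`, so that `n = N₁ + N₂ + 1`.

Modulo the relations `xᵢyᵢ = 0` a monomial is a word of `n` signed letters, a positive letter being
an exponent of `xᵢ` and a negative one an exponent of `yᵢ`.  The monomials outside the ideal are the
words with at most `N₁` positive and at most `N₂` negative letters; when such a word is sorted
increasingly, the letter at the (0-based) position `N₂` is `0`.

By the Robinson–Schensted–Knuth correspondence, the words that sort to `a₀ ≤ ⋯ ≤ aₙ₋₁` are as many
as the pairs `(T, U)` of standard tableaux of the same shape with `U` compatible with `a`:
`aᵢ < aᵢ₊₁` whenever `i + 1` lies in a higher row of `U` than `i`.  Only this identity of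
cardinalities is needed; it follows from Pieri's rule by induction on the number of distinct
letters, since both sides satisfy the recursion of the multinomial coefficients.

For fixed `U`, the least solution `a` of these inequalities with value `0` at the position `N₂` is
the cocharge of `U` shifted to vanish there.  The other solutions arise from it by adding arbitrary
nonnegative amounts to the `N₁` differences after that position and to the `N₂` differences before
it, which yields the factor `1 / ((t)_{N₁} (q)_{N₂})`.

Finally `(T, U) ↦ [T, C_γ(U)]_per` is injective.  The smallest letter that the monomials of a
bipermanent carry at `i` is the entry of the filling in the first cell of the row of `i`, so the
bipermanent determines the rows of `T`; and sorting the letters paired with their rows recovers `U`.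
-/

open Finset

section Strips

/-- `s` is the multiset of row indices of the cells of a Ferrers diagram. -/
def IsRowContent (s : Multiset ℕ) : Prop := ∀ i, s.count (i + 1) ≤ s.count i

/-- The Ferrers diagram with row content `t` arises from the one with row content `s` by adding a
horizontal strip. -/
def IsHorizontalStrip (s t : Multiset ℕ) : Prop :=
  ∀ i, s.count i ≤ t.count i ∧ t.count (i + 1) ≤ s.count i

variable {s t : Multiset ℕ} {r : ℕ}

theorem IsRowContent.mem_of_le (hs : IsRowContent s) {i j : ℕ} (hij : i ≤ j) (hj : j ∈ s) :
    i ∈ s := by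
  rw [← Multiset.count_pos] at hj ⊢
  exact hj.trans_le (antitone_nat_of_succ_le (f := fun k => s.count k) hs hij)

theorem IsRowContent.lt_card (hs : IsRowContent s) (hr : r ∈ s) : r < s.card := by
  have h : Finset.range (r + 1) ⊆ s.toFinset := fun i hi =>
    Multiset.mem_toFinset.2 (hs.mem_of_le (Finset.mem_range_succ_iff.1 hi) hr)
  simpa using (Finset.card_le_card h).trans s.toFinset_card_le

theorem IsHorizontalStrip.le (h : IsHorizontalStrip s t) : s ≤ t :=
  Multiset.le_iff_count.2 fun i => (h i).1

theorem IsHorizontalStrip.isRowContent_left (h : IsHorizontalStrip s t) : IsRowContent s :=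
  fun i => (h (i + 1)).1.trans (h i).2

theorem IsHorizontalStrip.isRowContent_right (h : IsHorizontalStrip s t) : IsRowContent t :=
  fun i => (h i).2.trans (h i).1

theorem isHorizontalStrip_zero_right : IsHorizontalStrip s 0 ↔ s = 0 :=
  ⟨fun h => by simpa using h.le, by rintro rfl; simp [IsHorizontalStrip]⟩

theorem isHorizontalStrip_cons_iff (h : IsHorizontalStrip s t) :
    IsHorizontalStrip s (r ::ₘ t) ↔ r = 0 ∨ ∃ i, r = i + 1 ∧ t.count (i + 1) < s.count i := by
  constructor
  · intro h'
    rcases r with _ | i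
    · exact Or.inl rfl
    · have := (h' i).2
      rw [Multiset.count_cons_self] at this
      exact Or.inr ⟨i, rfl, this⟩
  · intro hr j
    have := h j
    simp only [Multiset.count_cons]
    grind

theorem mem_and_isHorizontalStrip_erase_iff (h : IsHorizontalStrip s t) :
    (r ∈ s ∧ IsHorizontalStrip (s.erase r) t) ↔ t.count (r + 1) < s.count r := by
  constructor
  · rintro ⟨hr, h'⟩
    have := (h' r).2
    rw [Multiset.count_erase_self] at this
    have := Multiset.count_pos.2 hr
    omega
  · refine fun hr => ⟨Multiset.count_pos.1 (by omega), fun j => ?_⟩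
    have := h j
    rcases eq_or_ne j r with rfl | hj
    · rw [Multiset.count_erase_self]; omega
    · rwa [Multiset.count_erase_of_ne hj]

theorem isHorizontalStrip_cons_iff_of_not (hs : IsRowContent s) (ht : IsRowContent t)
    (h : ¬ IsHorizontalStrip s t) :
    IsHorizontalStrip s (r ::ₘ t) ↔ r ∈ s ∧ IsHorizontalStrip (s.erase r) t := by
  constructor
  · intro h'
    obtain ⟨j, hj⟩ : ∃ j, t.count j < s.count j := by
      by_contra! hle
      exact h fun j => ⟨hle j, (Multiset.count_le_count_cons _ _ _).trans (h' j).2⟩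
    have hcount := fun i => h' i
    simp only [Multiset.count_cons] at hcount
    obtain rfl : j = r := by have := hcount j; grind
    refine ⟨Multiset.count_pos.1 (by omega), fun i => ?_⟩
    rcases eq_or_ne i j with rfl | hij
    · have := ht i
      have := hcount i
      rw [Multiset.count_erase_self]
      grind
    · have := hcount i
      rw [Multiset.count_erase_of_ne hij]
      grind
  · rintro ⟨hr, h'⟩ i
    obtain ⟨j, hj⟩ : ∃ j, t.count j < s.count j := by
      by_contra! hle
      exact h fun j => ⟨hle j, (h' j).2.trans (Multiset.count_le_of_le _ (Multiset.erase_le _ _))⟩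
    obtain rfl : j = r := by
      by_contra hne
      have := (h' j).1
      rw [Multiset.count_erase_of_ne hne] at this
      omega
    have := h' i
    have := hs i
    simp only [Multiset.count_cons]
    rcases eq_or_ne i j with rfl | hij
    · rw [Multiset.count_erase_self] at *
      grind
    · rw [Multiset.count_erase_of_ne hij] at *
      grind

open Classical in
theorem card_cons_strips_eq_add (hs : IsRowContent s) (ht : IsRowContent t) :
    #{r ∈ range (t.card + 1) | IsHorizontalStrip s (r ::ₘ t)} =
      #{r ∈ s.toFinset | IsHorizontalStrip (s.erase r) t} +
        if IsHorizontalStrip s t then 1 else 0 := by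
  have mem_range_of_strip {r : ℕ} (h : IsHorizontalStrip s (r ::ₘ t)) : r ∈ range (t.card + 1) := by
    simpa using h.isRowContent_right.lt_card (Multiset.mem_cons_self r t)
  by_cases h : IsHorizontalStrip s t
  · have insert_shift : {r ∈ range (t.card + 1) | IsHorizontalStrip s (r ::ₘ t)} =
        insert 0 ({r ∈ s.toFinset | IsHorizontalStrip (s.erase r) t}.image (· + 1)) := by
      ext r
      rw [mem_filter, and_iff_right_of_imp mem_range_of_strip, isHorizontalStrip_cons_iff h]
      simp only [mem_insert, mem_image, mem_filter, Multiset.mem_toFinset,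
        mem_and_isHorizontalStrip_erase_iff h]
      grind
    rw [if_pos h, insert_shift, card_insert_of_notMem (by simp),
      card_image_of_injective _ (add_left_injective 1)]
  · rw [if_neg h, add_zero]
    congr 1
    ext r
    rw [mem_filter, and_iff_right_of_imp mem_range_of_strip, mem_filter, Multiset.mem_toFinset,
      isHorizontalStrip_cons_iff_of_not hs ht h]

end Strips

section LatticeWords

/-- Lattice words read from right to left: every suffix has the row content of a Ferrers
diagram. -/
def IsLatticeWord (w : List ℕ) : Prop := ∀ v : List ℕ, v <:+ w → IsRowContent v

theorem IsLatticeWord.isRowContent {w : List ℕ} (h : IsLatticeWord w) : IsRowContent w :=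
  h w w.suffix_refl

theorem isLatticeWord_nil : IsLatticeWord [] := by
  rintro v hv i
  simp [List.suffix_nil.1 hv]

theorem isLatticeWord_cons {r : ℕ} {w : List ℕ} :
    IsLatticeWord (r :: w) ↔ IsRowContent ↑(r :: w) ∧ IsLatticeWord w := by
  simp only [IsLatticeWord, List.suffix_cons_iff, forall_eq_or_imp]

open Classical in
/-- The lattice words of length `n`. -/
noncomputable def latticeWords : ℕ → Finset (List ℕ)
  | 0 => {[]}
  | n + 1 => (latticeWords n ×ˢ range (n + 1)).image (fun p => p.2 :: p.1) |>.filter IsLatticeWord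

theorem mem_latticeWords {n : ℕ} {w : List ℕ} :
    w ∈ latticeWords n ↔ w.length = n ∧ IsLatticeWord w := by
  induction n generalizing w with
  | zero =>
    rw [latticeWords, mem_singleton, List.length_eq_zero_iff, iff_self_and]
    rintro rfl
    exact isLatticeWord_nil
  | succ n ih =>
    simp only [latticeWords, mem_filter, mem_image, mem_product, mem_range, ih, Prod.exists]
    refine ⟨by rintro ⟨⟨w, r, ⟨⟨rfl, -⟩, -⟩, rfl⟩, h⟩; exact ⟨rfl, h⟩, fun ⟨hn, h⟩ => ⟨?_, h⟩⟩
    obtain ⟨r, w, rfl⟩ := List.exists_cons_of_length_eq_add_one hn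
    have hr : r < (r :: w).length := h.isRowContent.lt_card (List.mem_cons_self ..)
    exact ⟨w, r, ⟨⟨Nat.succ_injective hn, (isLatticeWord_cons.1 h).2⟩, hn ▸ hr⟩, rfl⟩

open Classical in
theorem sum_latticeWords_succ {M : Type*} [AddCommMonoid M] (n : ℕ) (g : List ℕ → M) :
    ∑ w ∈ latticeWords (n + 1), g w =
      ∑ w ∈ latticeWords n, ∑ r ∈ range (n + 1) with IsRowContent ↑(r :: w), g (r :: w) := by
  rw [latticeWords, sum_filter, sum_image fun p _ q _ h => by grind, sum_product]
  refine sum_congr rfl fun w hw => ?_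
  simp only [sum_filter, isLatticeWord_cons, (mem_latticeWords.1 hw).2, and_true]

open Classical in
/-- The number of lattice words of content `s`. -/
noncomputable def latticeCount (s : Multiset ℕ) : ℕ :=
  #{w ∈ latticeWords s.card | Multiset.ofList w = s}

theorem latticeCount_zero : latticeCount 0 = 1 := by
  simp [latticeCount, latticeWords, filter_singleton]

open Classical in
theorem latticeCount_eq_sum_erase {s : Multiset ℕ} (hs : IsRowContent s) (h0 : s ≠ 0) :
    latticeCount s = ∑ r ∈ s.toFinset, latticeCount (s.erase r) := by
  obtain ⟨n, hn⟩ := Nat.exists_eq_succ_of_ne_zero (Multiset.card_eq_zero.not.2 h0)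
  have erase_count {r : ℕ} (hr : r ∈ s.toFinset) :
      latticeCount (s.erase r) =
        ∑ w ∈ latticeWords n, if Multiset.ofList w = s.erase r then 1 else 0 := by
    rw [latticeCount, Multiset.card_erase_of_mem (Multiset.mem_toFinset.1 hr), hn, Nat.pred_succ,
      card_filter]
  rw [sum_congr rfl fun r => erase_count, sum_comm, latticeCount, hn, card_filter,
    sum_latticeWords_succ]
  refine sum_congr rfl fun w _ => ?_
  rw [← card_filter, ← card_filter, filter_filter]
  congr 1
  ext r
  simp only [mem_filter, mem_range, Multiset.mem_toFinset]
  constructor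
  · rintro ⟨-, -, rfl⟩
    simp
  · rintro ⟨hr, hw'⟩
    have hcons : ↑(r :: w) = s := by rw [← Multiset.cons_coe, hw', Multiset.cons_erase hr]
    exact ⟨(hs.lt_card hr).trans_eq hn, hcons ▸ hs, hcons⟩

theorem latticeCount_eq_zero {s : Multiset ℕ} (hs : ¬ IsRowContent s) : latticeCount s = 0 := by
  refine card_eq_zero.2 (filter_eq_empty_iff.2 fun w hw h => hs ?_)
  exact h ▸ (mem_latticeWords.1 hw).2.isRowContent

open Classical in
theorem sum_isHorizontalStrip_cons {s : Multiset ℕ} (hs : IsRowContent s) {n : ℕ} {w : List ℕ}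
    (hw : w ∈ latticeWords n) :
    (∑ r ∈ range (n + 1) with IsRowContent ↑(r :: w),
        if IsHorizontalStrip s ↑(r :: w) then 1 else 0) =
      (∑ r ∈ s.toFinset, if IsHorizontalStrip (s.erase r) w then 1 else 0) +
        if IsHorizontalStrip s w then 1 else 0 := by
  obtain ⟨rfl, hlattice⟩ := mem_latticeWords.1 hw
  rw [← card_filter, ← card_filter, filter_filter, ← Multiset.coe_card w,
    ← card_cons_strips_eq_add hs hlattice.isRowContent]
  exact congrArg card (filter_congr fun r _ =>
    and_iff_right_of_imp IsHorizontalStrip.isRowContent_right)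

open Classical in
/-- Pieri's rule, counted in standard tableaux: the numbers `f` of standard tableaux satisfy
`∑ f(λ) = (n choose |μ|) f(μ)`, where `λ` has `n` cells and `λ / μ` is a horizontal strip. -/
theorem card_latticeWords_isHorizontalStrip (n : ℕ) (s : Multiset ℕ) :
    #{w ∈ latticeWords n | IsHorizontalStrip s (.ofList w)} = n.choose s.card * latticeCount s := by
  induction n generalizing s with
  | zero =>
    rw [latticeWords, filter_singleton, Multiset.coe_nil, isHorizontalStrip_zero_right]
    split_ifs with h
    · simp [h, latticeCount_zero]
    · rw [Nat.choose_eq_zero_of_lt (Multiset.card_pos.2 h), zero_mul, card_empty]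
  | succ n ih =>
    by_cases hs : IsRowContent s
    · rw [card_filter, sum_latticeWords_succ, sum_congr rfl fun w => sum_isHorizontalStrip_cons hs,
        sum_add_distrib, sum_comm, ← card_filter, ih]
      simp only [← card_filter, ih]
      rcases eq_or_ne s 0 with rfl | h0
      · simp
      · obtain ⟨k, hk⟩ := Nat.exists_eq_succ_of_ne_zero (Multiset.card_eq_zero.not.2 h0)
        have card_erase {r : ℕ} (hr : r ∈ s.toFinset) : (s.erase r).card = k := by
          rw [Multiset.card_erase_of_mem (Multiset.mem_toFinset.1 hr), hk, Nat.pred_succ]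
        rw [sum_congr rfl fun r hr => by rw [card_erase hr], ← mul_sum,
          ← latticeCount_eq_sum_erase hs h0, hk, Nat.choose_succ_succ, add_mul]
    · rw [latticeCount_eq_zero hs, mul_zero, card_eq_zero]
      exact filter_eq_empty_iff.2 fun w _ h => hs h.isRowContent_left

end LatticeWords

section Compatible

variable {α : Type*} [LinearOrder α]

/-- The biletter with top entry `x` and bottom entry `r`.  Biletters are ordered by the top entry,
and then decreasingly by the bottom entry. -/
def biletter (x : α) (r : ℕ) : α ×ₗ ℕᵒᵈ := toLex (x, OrderDual.toDual r)

theorem biletter_le_biletter {x y : α} {r s : ℕ} :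
    biletter x r ≤ biletter y s ↔ x < y ∨ x = y ∧ s ≤ r := by
  simp [biletter, Prod.Lex.toLex_le_toLex]

/-- The biletters formed by a word `a` and a word of row indices, both read from right to left, are
sorted. -/
def IsCompatibleWord (w : List ℕ) (a : List α) : Prop :=
  (List.zipWith biletter a w).Pairwise (· ≥ ·)

theorem isCompatibleWord_append_iff {v w : List ℕ} {z : α} {a : List α} (ha : ∀ y ∈ a, y < z) :
    IsCompatibleWord (v ++ w) (List.replicate v.length z ++ a) ↔
      v.Pairwise (· ≤ ·) ∧ IsCompatibleWord w a := by
  have zipWith_replicate : List.zipWith biletter (List.replicate v.length z) v =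
      v.map (biletter z) := by
    induction v <;> simp_all [List.replicate_succ]
  rw [IsCompatibleWord, List.zipWith_append (by simp), zipWith_replicate, List.pairwise_append,
    List.pairwise_map]
  simp only [ge_iff_le, biletter_le_biletter, lt_self_iff_false, true_and, false_or]
  refine and_congr_right fun _ => and_iff_left ?_
  intro p hp q hq
  obtain ⟨r, -, rfl⟩ := List.mem_map.1 hp
  obtain ⟨y, s, hys, rfl⟩ : ∃ y s, (y, s) ∈ a.zip w ∧ biletter y s = q := by
    simpa [← List.map_uncurry_zip_eq_zipWith] using hq
  exact biletter_le_biletter.2 (Or.inl (ha _ (List.of_mem_zip hys).1))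

theorem isLatticeWord_append_iff {v w : List ℕ} (hv : v.Pairwise (· ≤ ·)) :
    IsLatticeWord (v ++ w) ↔ IsLatticeWord w ∧ IsHorizontalStrip w (v ++ w : List ℕ) := by
  induction v with
  | nil =>
    exact iff_self_and.2 fun h i => ⟨le_rfl, h.isRowContent i⟩
  | cons r v ih =>
    rw [List.pairwise_cons] at hv
    rw [List.cons_append, isLatticeWord_cons, ih hv.2, and_left_comm]
    refine and_congr_right fun hw => ?_
    have count_eq_zero : ∀ i < r, v.count i = 0 := fun i hi =>
      List.count_eq_zero.2 fun h => hi.not_ge (hv.1 i h)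
    have hw' := hw.isRowContent
    simp only [IsRowContent, IsHorizontalStrip, Multiset.coe_count, List.count_append,
      List.count_cons, beq_iff_eq] at hw' ⊢
    constructor
    · rintro ⟨hr, hv⟩ i
      grind
    · intro h
      refine ⟨fun i => ?_, fun i => ?_⟩ <;> grind

open Classical in
/-- The lattice words compatible with `a`. -/
noncomputable def compatibleWords (a : List α) : Finset (List ℕ) :=
  {w ∈ latticeWords a.length | IsCompatibleWord w a}

theorem mem_compatibleWords {w : List ℕ} {a : List α} :
    w ∈ compatibleWords a ↔ (w.length = a.length ∧ IsLatticeWord w) ∧ IsCompatibleWord w a := by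
  simp only [compatibleWords, mem_filter, mem_latticeWords]

open Classical in
theorem card_compatibleWords_replicate_append {k : ℕ} {z : α} {a : List α} (ha : ∀ y ∈ a, y < z)
    {t : Multiset ℕ} (ht : t.card = k + a.length) :
    #{w ∈ compatibleWords (List.replicate k z ++ a) | t = .ofList w} =
      #{u ∈ compatibleWords a | IsHorizontalStrip (.ofList u) t} := by
  symm
  refine card_bij (fun u _ => (t - .ofList u).sort ++ u) ?_ ?_ ?_
  · intro u hu
    obtain ⟨⟨⟨hlen, hlattice⟩, hcompat⟩, hstrip⟩ := by
      simpa only [mem_filter, mem_compatibleWords] using hu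
    have hcontent : Multiset.ofList ((t - .ofList u).sort ++ u) = t := by
      rw [← Multiset.coe_add, Multiset.sort_eq, tsub_add_cancel_of_le hstrip.le]
    have hk : ((t - .ofList u).sort).length = k := by
      rw [Multiset.length_sort, Multiset.card_sub hstrip.le, Multiset.coe_card, ht, hlen,
        Nat.add_sub_cancel]
    have hsort := Multiset.pairwise_sort (t - .ofList u) (· ≤ ·)
    rw [mem_filter, mem_compatibleWords, isLatticeWord_append_iff hsort, hcontent, ← hk,
      isCompatibleWord_append_iff ha]
    exact ⟨⟨⟨by simp [hlen], hlattice, hstrip⟩, hsort, hcompat⟩, rfl⟩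
  · intro u hu v hv h
    have hu := (mem_compatibleWords.1 (mem_filter.1 hu).1).1.1
    have hv := (mem_compatibleWords.1 (mem_filter.1 hv).1).1.1
    exact List.append_inj_right' h (hu.trans hv.symm)
  · intro w hw
    obtain ⟨⟨⟨hlen, hlattice⟩, hcompat⟩, rfl⟩ := by
      simpa only [mem_filter, mem_compatibleWords] using hw
    rw [List.length_append, List.length_replicate] at hlen
    obtain ⟨v, u, rfl, rfl⟩ : ∃ v u, w = v ++ u ∧ k = v.length :=
      ⟨w.take k, w.drop k, by simp, by simp; omega⟩
    rw [isCompatibleWord_append_iff ha] at hcompat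
    rw [isLatticeWord_append_iff hcompat.1] at hlattice
    refine ⟨u, ?_, ?_⟩
    · rw [mem_filter, mem_compatibleWords]
      exact ⟨⟨⟨by simpa using hlen, hlattice.1⟩, hcompat.2⟩, hlattice.2⟩
    · rw [← Multiset.coe_add, add_tsub_cancel_right, Multiset.coe_sort,
        List.mergeSort_eq_self _ (by simpa using hcompat.1)]

/-- The number of pairs of lattice words of the same content the second of which is compatible
with `a`. -/
noncomputable def latticePairCount (a : List α) : ℕ :=
  ∑ w ∈ compatibleWords a, latticeCount w

theorem latticePairCount_nil : latticePairCount ([] : List α) = 1 := by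
  simp [latticePairCount, compatibleWords, latticeWords, IsCompatibleWord, latticeCount_zero,
    filter_singleton]

open Classical in
theorem latticePairCount_replicate_append {k : ℕ} {z : α} {a : List α} (ha : ∀ y ∈ a, y < z) :
    latticePairCount (List.replicate k z ++ a) =
      (k + a.length).choose a.length * latticePairCount a := by
  set n := k + a.length
  calc latticePairCount (List.replicate k z ++ a)
      = ∑ w ∈ compatibleWords (List.replicate k z ++ a),
          #{v ∈ latticeWords n | Multiset.ofList v = .ofList w} := by
        refine sum_congr rfl fun w hw => ?_
        rw [latticeCount, Multiset.coe_card, (mem_compatibleWords.1 hw).1.1, List.length_append,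
          List.length_replicate]
    _ = ∑ v ∈ latticeWords n, #{w ∈ compatibleWords (List.replicate k z ++ a) |
          Multiset.ofList v = .ofList w} :=
        sum_card_bipartiteAbove_eq_sum_card_bipartiteBelow _
    _ = ∑ v ∈ latticeWords n,
          #{u ∈ compatibleWords a | IsHorizontalStrip (.ofList u) (.ofList v)} :=
        sum_congr rfl fun v hv =>
          card_compatibleWords_replicate_append ha (mem_latticeWords.1 hv).1
    _ = ∑ u ∈ compatibleWords a,
          #{v ∈ latticeWords n | IsHorizontalStrip (.ofList u) (.ofList v)} :=
        (sum_card_bipartiteAbove_eq_sum_card_bipartiteBelow _).symm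
    _ = n.choose a.length * latticePairCount a := by
        rw [latticePairCount, mul_sum]
        refine sum_congr rfl fun u hu => ?_
        rw [card_latticeWords_isHorizontalStrip, Multiset.coe_card,
          (mem_compatibleWords.1 hu).1.1]

theorem exists_eq_replicate_append {z : α} {a : List α} (h : (z :: a).Pairwise (· ≥ ·)) :
    ∃ (k : ℕ) (b : List α), z :: a = List.replicate (k + 1) z ++ b ∧ ∀ y ∈ b, y < z := by
  induction a with
  | nil => exact ⟨0, [], rfl, by simp⟩
  | cons y a ih =>
    obtain ⟨hz, hy⟩ := List.pairwise_cons.1 h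
    rcases (hz y List.mem_cons_self).eq_or_lt with rfl | hlt
    · obtain ⟨k, b, hk, hb⟩ := ih hy
      exact ⟨k + 1, b, by rw [hk]; rfl, hb⟩
    · refine ⟨0, y :: a, rfl, List.forall_mem_cons.2 ⟨hlt, fun x hx => ?_⟩⟩
      exact ((List.pairwise_cons.1 hy).1 x hx).trans_lt hlt

theorem countPerms_replicate_append {k : ℕ} {z : α} {b : List α} (hb : z ∉ b) :
    (Multiset.ofList (List.replicate k z ++ b)).countPerms =
      (k + b.length).choose b.length * (Multiset.ofList b).countPerms := by
  rw [Multiset.countPerms_filter_ne z, Multiset.filter_coe, List.filter_append,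
    List.filter_eq_nil_iff.2 (by simp), List.filter_eq_self.2 (by grind), List.nil_append,
    Multiset.coe_card, Multiset.coe_count, List.count_append, List.count_eq_zero.2 hb]
  simp [Nat.choose_symm_add (a := k)]

/-- Both sides are the same multinomial coefficient: every block of equal letters contributes one
binomial factor. -/
theorem latticePairCount_eq_countPerms {a : List α} (ha : a.Pairwise (· ≥ ·)) :
    latticePairCount a = (Multiset.ofList a).countPerms := by
  obtain ⟨n, hn⟩ : ∃ n, a.length = n := ⟨_, rfl⟩
  induction n using Nat.strong_induction_on generalizing a with
  | _ n ih =>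
    rcases a with _ | ⟨z, a⟩
    · rw [latticePairCount_nil, Multiset.coe_nil, Multiset.countPerms_zero]
    · obtain ⟨k, b, hsplit, hb⟩ := exists_eq_replicate_append ha
      rw [hsplit] at ha hn ⊢
      rw [latticePairCount_replicate_append hb,
        countPerms_replicate_append fun h => lt_irrefl z (hb z h),
        ih b.length (by simp at hn; omega) (List.pairwise_append.1 ha).2.1 rfl]

end Compatible

section RowWords

variable {n : ℕ} (r : Fin n → ℕ)

/-- The number of positions before `k` at which `r` takes the value `i`. -/
def prefixCount (k i : ℕ) : ℕ := #{j : Fin n | j.val < k ∧ r j = i}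

theorem prefixCount_mono {k l : ℕ} (h : k ≤ l) (i : ℕ) : prefixCount r k i ≤ prefixCount r l i :=
  card_le_card <| monotone_filter_right _ fun _ _ hj => ⟨hj.1.trans_le h, hj.2⟩

theorem prefixCount_succ (j : Fin n) (i : ℕ) :
    prefixCount r (j + 1) i = prefixCount r j i + if r j = i then 1 else 0 := by
  have key : ({x : Fin n | x.val < j + 1 ∧ r x = i} : Finset (Fin n)) =
      ({x : Fin n | x.val < j ∧ r x = i} : Finset (Fin n)) ∪ if r j = i then {j} else ∅ := by
    ext x
    have : x.val = j ↔ x = j := Fin.val_inj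
    split_ifs <;> grind
  rw [prefixCount, key, card_union_of_disjoint]
  · split_ifs <;> rfl
  · split_ifs <;> simp

theorem prefixCount_lt {j : Fin n} {k : ℕ} (h : j.val < k) :
    prefixCount r j (r j) < prefixCount r k (r j) := by
  have := prefixCount_mono r (Nat.succ_le_of_lt h) (r j)
  rwa [Nat.succ_eq_add_one, prefixCount_succ, if_pos rfl, Nat.add_one_le_iff] at this

variable {r} in
theorem eq_of_prefixCount_eq {i j : Fin n} (hr : r i = r j)
    (h : prefixCount r i (r i) = prefixCount r j (r j)) : i = j := by
  by_contra hne
  rcases lt_or_gt_of_ne hne with hij | hji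
  · exact (prefixCount_lt r hij).ne (h.trans (hr ▸ rfl))
  · exact (prefixCount_lt r hji).ne (h.symm.trans (hr ▸ rfl))

variable {r} in
theorem exists_prefixCount_eq {k i c : ℕ} (hk : k ≤ n) (hc : c < prefixCount r k i) :
    ∃ j, r j = i ∧ prefixCount r j i = c := by
  induction k with
  | zero => simp [prefixCount] at hc
  | succ k ih =>
    by_cases h : c < prefixCount r k i
    · exact ih (by omega) h
    · have := prefixCount_succ r ⟨k, hk⟩ i
      exact ⟨⟨k, hk⟩, by grind⟩

theorem count_take_ofFn {k : ℕ} (hk : k ≤ n) (i : ℕ) :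
    ((List.ofFn r).take k).count i = prefixCount r k i := by
  induction k with
  | zero => simp [prefixCount]
  | succ k ih =>
    rw [List.take_add_one, List.count_append, ih (by omega), prefixCount_succ r ⟨k, hk⟩]
    simp [Nat.lt_of_succ_le hk, List.count_singleton]

theorem count_reverse_ofFn (i : ℕ) : (List.ofFn r).reverse.count i = prefixCount r n i := by
  rw [List.count_reverse, ← count_take_ofFn r le_rfl, List.take_of_length_le (by simp)]

theorem isLatticeWord_reverse_ofFn :
    IsLatticeWord (List.ofFn r).reverse ↔
      ∀ k ≤ n, ∀ i, prefixCount r k (i + 1) ≤ prefixCount r k i := by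
  constructor
  · intro h k hk i
    rw [← count_take_ofFn r hk, ← count_take_ofFn r hk]
    simpa using h _ (List.reverse_suffix.2 (List.take_prefix k _)) i
  · intro h v hv i
    obtain ⟨w, rfl⟩ : ∃ w, v = w.reverse := ⟨v.reverse, v.reverse_reverse.symm⟩
    rw [List.reverse_suffix, List.prefix_iff_eq_take] at hv
    have hw : w.length ≤ n := by simpa using congrArg List.length hv
    rw [Multiset.coe_count, Multiset.coe_count, List.count_reverse, List.count_reverse, hv,
      count_take_ofFn r hw, count_take_ofFn r hw]
    exact h _ hw i

theorem exists_eq_reverse_ofFn {α : Type*} {w : List α} (hw : w.length = n) :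
    ∃ f : Fin n → α, w = (List.ofFn f).reverse := by
  subst hw
  refine ⟨fun i => w[Fin.rev i], List.ext_getElem (by simp) fun i hi _ => ?_⟩
  simp only [List.getElem_reverse, List.getElem_ofFn, Fin.getElem_fin, Fin.val_rev]
  congr 1
  simp only [List.length_ofFn]
  omega

end RowWords

namespace StdTableau

variable {μ : YoungDiagram} {n : ℕ} (T : StdTableau μ n) {i j : Fin n}

theorem row_col_mem (i : Fin n) : (T.row i, T.col i) ∈ μ :=
  (YoungDiagram.mem_cells _).1 (T.entry.symm i).2

theorem col_lt_rowLen (i : Fin n) : T.col i < μ.rowLen (T.row i) :=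
  YoungDiagram.mem_iff_lt_rowLen.1 (T.row_col_mem i)

theorem exists_row_col_eq {a b : ℕ} (h : (a, b) ∈ μ) : ∃ i, T.row i = a ∧ T.col i = b :=
  ⟨T.entry ⟨(a, b), (YoungDiagram.mem_cells _).2 h⟩, by simp [row], by simp [col]⟩

variable {T}

theorem eq_of_row_eq_of_col_eq (hrow : T.row i = T.row j) (hcol : T.col i = T.col j) : i = j :=
  T.entry.symm.injective (Subtype.ext (Prod.ext hrow hcol))

theorem lt_of_row_eq_of_col_lt (hrow : T.row i = T.row j) (hcol : T.col i < T.col j) : i < j := by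
  simpa using T.row_lt (T.entry.symm i) (T.entry.symm j) hrow hcol

theorem lt_of_col_eq_of_row_lt (hcol : T.col i = T.col j) (hrow : T.row i < T.row j) : i < j := by
  simpa using T.col_lt (T.entry.symm i) (T.entry.symm j) hcol hrow

theorem le_of_row_le_of_col_le (hrow : T.row i ≤ T.row j) (hcol : T.col i ≤ T.col j) : i ≤ j := by
  obtain ⟨k, hkrow, hkcol⟩ := T.exists_row_col_eq (μ.up_left_mem hrow le_rfl (T.row_col_mem j))
  calc i ≤ k := by
        rcases hcol.eq_or_lt with h | h
        · exact (eq_of_row_eq_of_col_eq hkrow.symm (h.trans hkcol.symm)).le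
        · exact (lt_of_row_eq_of_col_lt hkrow.symm (hkcol ▸ h)).le
    _ ≤ j := by
        rcases hrow.eq_or_lt with h | h
        · exact (eq_of_row_eq_of_col_eq (hkrow.trans h) hkcol).le
        · exact (lt_of_col_eq_of_row_lt hkcol (hkrow ▸ h)).le

theorem col_lt_col_iff (hrow : T.row i = T.row j) : T.col i < T.col j ↔ i < j :=
  ⟨lt_of_row_eq_of_col_lt hrow,
    lt_imp_lt_of_le_imp_le fun h => le_of_row_le_of_col_le hrow.symm.le h⟩

theorem prefixCount_row_of_forall_iff {k i c : ℕ} (hc : c ≤ μ.rowLen i)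
    (h : ∀ x, T.row x = i → (x.val < k ↔ T.col x < c)) : prefixCount T.row k i = c := by
  rw [prefixCount, ← card_range c]
  refine card_bij (fun x _ => T.col x) ?_ ?_ ?_
  · simp only [mem_filter_univ, mem_range]
    exact fun x hx => (h x hx.2).1 hx.1
  · simp only [mem_filter_univ]
    exact fun x hx y hy hxy => eq_of_row_eq_of_col_eq (hx.2.trans hy.2.symm) hxy
  · intro b hb
    rw [mem_range] at hb
    obtain ⟨x, hrow, rfl⟩ :=
      T.exists_row_col_eq (YoungDiagram.mem_iff_lt_rowLen.2 (hb.trans_le hc))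
    exact ⟨x, mem_filter_univ x |>.2 ⟨(h x hrow).2 hb, hrow⟩, rfl⟩

variable (T)

theorem prefixCount_row (j : Fin n) : prefixCount T.row j (T.row j) = T.col j :=
  prefixCount_row_of_forall_iff (T.col_lt_rowLen j).le fun _ hx => (col_lt_col_iff hx).symm

theorem prefixCount_row_eq_rowLen (i : ℕ) : prefixCount T.row n i = μ.rowLen i :=
  prefixCount_row_of_forall_iff le_rfl fun x hx => by simp [← hx, T.col_lt_rowLen x]

theorem prefixCount_row_succ_le (k i : ℕ) :
    prefixCount T.row k (i + 1) ≤ prefixCount T.row k i := by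
  have exists_below : ∀ x, T.row x = i + 1 → ∃ y, T.row y = i ∧ T.col y = T.col x := fun x hx =>
    T.exists_row_col_eq (μ.up_left_mem (by omega) le_rfl (T.row_col_mem x))
  choose! below hrow hcol using exists_below
  refine card_le_card_of_injOn below (fun x hx => ?_) fun x hx y hy hxy => ?_
  · simp only [coe_filter, mem_univ, true_and, Set.mem_ofPred_eq] at hx ⊢
    have hlt : below x < x :=
      lt_of_col_eq_of_row_lt (hcol x hx.2) (by rw [hrow x hx.2, hx.2]; exact i.lt_succ_self)
    exact ⟨(Fin.lt_def.1 hlt).trans hx.1, hrow x hx.2⟩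
  · simp only [coe_filter, mem_univ, true_and, Set.mem_ofPred_eq] at hx hy
    exact eq_of_row_eq_of_col_eq (hx.2.trans hy.2.symm)
      (by rw [← hcol x hx.2, hxy, hcol y hy.2])

variable {T} in
theorem ext_row {U : StdTableau μ n} (h : T.row = U.row) : T = U := by
  have hcol : T.col = U.col := by
    funext j
    rw [← T.prefixCount_row, ← U.prefixCount_row, h]
  have hsymm : T.entry.symm = U.entry.symm :=
    Equiv.ext fun j => Subtype.ext (Prod.ext (congrFun h j) (congrFun hcol j))
  cases T; cases U; simpa using Equiv.symm_bijective.injective hsymm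

section OfRow

variable {r : Fin n → ℕ}

theorem bijective_row_prefixCount (hμ : ∀ i, prefixCount r n i = μ.rowLen i) :
    Function.Bijective fun j : Fin n =>
      (⟨(r j, prefixCount r j (r j)), (YoungDiagram.mem_cells _).2 <|
        YoungDiagram.mem_iff_lt_rowLen.2 (hμ (r j) ▸ prefixCount_lt r j.2)⟩ :
        {c // c ∈ μ.cells}) := by
  constructor
  · intro i j h
    simp only [Subtype.mk.injEq, Prod.mk.injEq] at h
    exact eq_of_prefixCount_eq h.1 h.2
  · rintro ⟨⟨a, b⟩, hab⟩
    rw [YoungDiagram.mem_cells, YoungDiagram.mem_iff_lt_rowLen, ← hμ] at hab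
    obtain ⟨j, rfl, rfl⟩ := exists_prefixCount_eq le_rfl hab
    exact ⟨j, rfl⟩

theorem lt_of_prefixCount_lt {i j : Fin n} (h : r i = r j)
    (hlt : prefixCount r i (r i) < prefixCount r j (r j)) : i < j :=
  lt_of_not_ge fun hji => hlt.not_ge (h ▸ prefixCount_mono r hji _)

/-- The standard tableau of shape `μ` in which the number `j + 1` is appended to the row `r j`. -/
noncomputable def ofRow (hr : ∀ k ≤ n, ∀ i, prefixCount r k (i + 1) ≤ prefixCount r k i)
    (hμ : ∀ i, prefixCount r n i = μ.rowLen i) : StdTableau μ n where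
  entry := (Equiv.ofBijective _ (bijective_row_prefixCount hμ)).symm
  row_lt := by
    refine (bijective_row_prefixCount hμ).surjective.forall₂.2 fun i j hrow hcol => ?_
    simpa only [Equiv.ofBijective_symm_apply_apply] using lt_of_prefixCount_lt hrow hcol
  col_lt := by
    refine (bijective_row_prefixCount hμ).surjective.forall₂.2 fun i j hcol hrow => ?_
    simp only [Equiv.ofBijective_symm_apply_apply]
    simp only at hcol hrow
    refine lt_of_not_ge fun hji => ?_
    have hji : j < i := hji.lt_of_ne fun h => hrow.ne (h ▸ rfl)
    refine hcol.not_gt ?_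
    calc prefixCount r j (r j)
      _ < prefixCount r (j + 1) (r j) := prefixCount_lt r j.val.lt_succ_self
      _ ≤ prefixCount r (j + 1) (r i) :=
          antitone_nat_of_succ_le (f := prefixCount r (j + 1)) (hr _ j.2) hrow.le
      _ ≤ prefixCount r i (r i) := prefixCount_mono r hji _

end OfRow

end StdTableau

section TableauPairs

theorem youngDiagram_ext_rowLen {μ ν : YoungDiagram} (h : ∀ i, μ.rowLen i = ν.rowLen i) :
    μ = ν := by
  apply YoungDiagram.ext
  ext ⟨i, j⟩
  simp only [YoungDiagram.mem_cells, YoungDiagram.mem_iff_lt_rowLen, h]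

theorem IsRowContent.exists_youngDiagram {s : Multiset ℕ} (hs : IsRowContent s) :
    ∃ μ : YoungDiagram, ∀ i, s.count i = μ.rowLen i := by
  have hanti : Antitone s.count := antitone_nat_of_succ_le hs
  set cells : Finset (ℕ × ℕ) := {c ∈ range s.card ×ˢ range s.card | c.2 < s.count c.1}
  have mem_cells (c) : c ∈ cells ↔ c.2 < s.count c.1 := by
    simp only [cells, mem_filter, mem_product, mem_range, and_iff_right_iff_imp]
    exact fun h => ⟨hs.lt_card (Multiset.count_pos.1 (by omega)),
      h.trans_le (Multiset.count_le_card _ _)⟩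
  refine ⟨⟨cells, fun c d hdc hc => ?_⟩, fun i => eq_of_forall_lt_iff fun j => ?_⟩
  · rw [mem_coe, mem_cells] at hc ⊢
    exact (hdc.2.trans_lt hc).trans_le (hanti hdc.1)
  · rw [← YoungDiagram.mem_iff_lt_rowLen]
    exact (mem_cells (i, j)).symm

variable {n : ℕ}

namespace StdTableau

variable {μ : YoungDiagram}

/-- The word of the rows of the numbers `n, …, 2, 1`, a lattice word in the sense of
`IsLatticeWord`. -/
def rowWord (T : StdTableau μ n) : List ℕ := (List.ofFn T.row).reverse

theorem rowWord_injective : Function.Injective (rowWord : StdTableau μ n → List ℕ) :=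
  fun _ _ h => ext_row (List.ofFn_injective (List.reverse_injective h))

theorem rowWord_mem_latticeWords (T : StdTableau μ n) : T.rowWord ∈ latticeWords n :=
  mem_latticeWords.2 ⟨by simp [rowWord],
    (isLatticeWord_reverse_ofFn _).2 fun k _ i => T.prefixCount_row_succ_le k i⟩

theorem count_rowWord (T : StdTableau μ n) (i : ℕ) : T.rowWord.count i = μ.rowLen i := by
  rw [rowWord, count_reverse_ofFn, prefixCount_row_eq_rowLen]

theorem exists_rowWord_eq {w : List ℕ} (hw : w ∈ latticeWords n)
    (hμ : ∀ i, w.count i = μ.rowLen i) : ∃ T : StdTableau μ n, T.rowWord = w := by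
  obtain ⟨hlen, hlattice⟩ := mem_latticeWords.1 hw
  obtain ⟨r, rfl⟩ := exists_eq_reverse_ofFn hlen
  simp only [count_reverse_ofFn] at hμ
  exact ⟨ofRow ((isLatticeWord_reverse_ofFn r).1 hlattice) hμ, rfl⟩

end StdTableau

/-- Pairs of standard tableaux of the same shape with `n` cells. -/
abbrev TableauPair (n : ℕ) : Type := Σ μ : YoungDiagram, StdTableau μ n × StdTableau μ n

namespace TableauPair

noncomputable instance (n : ℕ) : Fintype (TableauPair n) := by
  have := (finite_shapes n).to_subtype
  have : Finite (TableauPair n) := Finite.of_surjective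
    (fun P : Σ μ : {μ : YoungDiagram | Nonempty (StdTableau μ n)},
      StdTableau μ.1 n × StdTableau μ.1 n => ⟨P.1.1, P.2⟩)
    fun ⟨μ, T, U⟩ => ⟨⟨⟨μ, ⟨T⟩⟩, T, U⟩, rfl⟩
  exact Fintype.ofFinite _

theorem ext_rowWord {P Q : TableauPair n} (hT : P.2.1.rowWord = Q.2.1.rowWord)
    (hU : P.2.2.rowWord = Q.2.2.rowWord) : P = Q := by
  obtain ⟨μ, T, U⟩ := P
  obtain ⟨ν, T', U'⟩ := Q
  obtain rfl : μ = ν := youngDiagram_ext_rowLen fun i => by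
    rw [← T.count_rowWord, hT, T'.count_rowWord]
  obtain rfl : T = T' := StdTableau.rowWord_injective hT
  obtain rfl : U = U' := StdTableau.rowWord_injective hU
  rfl

theorem exists_rowWord_eq {v w : List ℕ} (hv : v ∈ latticeWords n) (hw : w ∈ latticeWords n)
    (h : Multiset.ofList v = .ofList w) :
    ∃ P : TableauPair n, P.2.1.rowWord = v ∧ P.2.2.rowWord = w := by
  obtain ⟨μ, hμ⟩ := (mem_latticeWords.1 hw).2.isRowContent.exists_youngDiagram
  obtain ⟨T, hT⟩ := StdTableau.exists_rowWord_eq hv (μ := μ) fun i => by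
    rw [← hμ, ← h, Multiset.coe_count]
  obtain ⟨U, hU⟩ := StdTableau.exists_rowWord_eq hw (μ := μ) fun i => by
    rw [← hμ, Multiset.coe_count]
  exact ⟨⟨μ, T, U⟩, hT, hU⟩

open Classical in
theorem card_rowWord_eq {w : List ℕ} (hw : w ∈ latticeWords n) :
    #{P : TableauPair n | P.2.2.rowWord = w} = latticeCount w := by
  refine card_bij (fun P _ => P.2.1.rowWord) ?_ ?_ ?_
  · rintro ⟨μ, T, U⟩ hP
    obtain rfl := (mem_filter_univ _).1 hP
    rw [mem_filter, Multiset.coe_card, (mem_latticeWords.1 hw).1]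
    refine ⟨T.rowWord_mem_latticeWords, Multiset.ext.2 fun i => ?_⟩
    simp only [Multiset.coe_count, T.count_rowWord, U.count_rowWord]
  · simp only [mem_filter_univ]
    exact fun P hP Q hQ h => ext_rowWord h (hP.trans hQ.symm)
  · intro v hv
    rw [mem_filter, Multiset.coe_card, (mem_latticeWords.1 hw).1] at hv
    obtain ⟨P, hPv, hPw⟩ := exists_rowWord_eq hv.1 hw hv.2
    exact ⟨P, (mem_filter_univ _).2 hPw, hPv⟩

open Classical in
theorem card_isCompatibleWord {α : Type*} [LinearOrder α] {a : List α} (ha : a.length = n) :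
    #{P : TableauPair n | IsCompatibleWord P.2.2.rowWord a} = latticePairCount a := by
  subst ha
  rw [latticePairCount, card_eq_sum_card_fiberwise (f := fun P => P.2.2.rowWord)
    (t := compatibleWords a)]
  · refine sum_congr rfl fun w hw => ?_
    rw [filter_filter, ← card_rowWord_eq (mem_filter.1 hw).1]
    congr 1 with P
    simp only [mem_filter_univ, and_iff_right_iff_imp]
    rintro rfl
    exact (mem_compatibleWords.1 hw).2
  · intro P hP
    exact mem_filter.2 ⟨P.2.2.rowWord_mem_latticeWords, (mem_filter.1 (mem_coe.1 hP)).2⟩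

end TableauPair

end TableauPairs

section SortedRearrangement

variable {α : Type*}

theorem prod_map_single_singleton (s : Multiset α) :
    (s.map fun x => AddMonoidAlgebra.single ({x} : Multiset α) (1 : ℕ)).prod =
      AddMonoidAlgebra.single s 1 := by
  induction s using Multiset.induction_on with
  | empty => rfl
  | cons x s ih =>
    rw [Multiset.map_cons, Multiset.prod_cons, ih, AddMonoidAlgebra.single_mul_single,
      Multiset.singleton_add, mul_one]

/-- Compare the coefficients of `s` in the multinomial theorem for `∑ x ∈ s, single {x} 1`. -/
theorem ncard_map_univ_eq_countPerms [DecidableEq α] {n : ℕ} {s : Multiset α} (hs : s.card = n) :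
    {u : Fin n → α | univ.val.map u = s}.ncard = s.countPerms := by
  set f : α → AddMonoidAlgebra ℕ (Multiset α) := fun x => .single {x} 1 with hf
  have hprod (p : Fin n → α) : ∏ i, f (p i) = .single (univ.val.map p) 1 := by
    rw [← prod_map_single_singleton, Multiset.map_map]
    rfl
  have hwords : {u : Fin n → α | univ.val.map u = s} =
      ({u ∈ Fintype.piFinset fun _ => s.toFinset | univ.val.map u = s} : Finset (Fin n → α)) := by
    ext u
    simp only [Set.mem_ofPred_eq, coe_filter, Fintype.mem_piFinset, Multiset.mem_toFinset,
      iff_and_self]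
    rintro rfl i
    exact Multiset.mem_map_of_mem u (mem_univ i)
  have hmem : (⟨s, hs⟩ : Sym α n) ∈ s.toFinset.sym n :=
    mem_sym_iff.2 fun x hx => Multiset.mem_toFinset.2 hx
  rw [hwords, Set.ncard_coe_finset]
  calc #{u ∈ Fintype.piFinset fun _ => s.toFinset | univ.val.map u = s}
      = (∑ u ∈ Fintype.piFinset fun _ : Fin n => s.toFinset, ∏ i, f (u i)).coeff s := by
        simp [hprod, Finsupp.single_apply]
    _ = (∑ k ∈ s.toFinset.sym n,
          (k : Multiset α).countPerms * ((k : Multiset α).map f).prod).coeff s :=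
        congrArg (fun g => g.coeff s) ((sum_pow' _ f n).symm.trans (sum_pow f n))
    _ = s.countPerms := by
        rw [AddMonoidAlgebra.coeff_sum, Finsupp.finsetSum_apply]
        refine (sum_eq_single_of_mem _ hmem fun (k : Sym α n) _ hk => ?_).trans ?_
        · have : (k : Multiset α) ≠ s := fun h => hk (Sym.coe_injective h)
          simp [hf, prod_map_single_singleton, ← nsmul_eq_mul, this]
        · simp [hf, prod_map_single_singleton, ← nsmul_eq_mul]

end SortedRearrangement

section RobinsonSchenstedKnuth

variable {α : Type*} [LinearOrder α] {n : ℕ}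

theorem comp_sort_eq_iff {a u : Fin n → α} (ha : Monotone a) :
    u ∘ Tuple.sort u = a ↔ univ.val.map u = univ.val.map a := by
  rw [Fin.univ_val_map, Fin.univ_val_map, Multiset.coe_eq_coe]
  constructor
  · rintro rfl
    exact ((Tuple.sort u).ofFn_comp_perm u).symm
  · intro h
    exact List.ofFn_injective ((((Tuple.sort u).ofFn_comp_perm u).trans h).eq_of_pairwise'
      (Tuple.monotone_sort u).sortedLE_ofFn.pairwise ha.sortedLE_ofFn.pairwise)

/-- The biletters formed by a sequence `a` and a sequence `r` of row indices increase weakly. -/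
def IsCompatible (r : Fin n → ℕ) (a : Fin n → α) : Prop :=
  Monotone fun i => biletter (a i) (r i)

theorem IsCompatible.monotone {r : Fin n → ℕ} {a : Fin n → α} (h : IsCompatible r a) :
    Monotone a := fun _ _ hij =>
  (biletter_le_biletter.1 (h hij)).elim le_of_lt fun h => h.1.le

theorem isCompatibleWord_reverse_ofFn {r : Fin n → ℕ} {a : Fin n → α} :
    IsCompatibleWord (List.ofFn r).reverse (List.ofFn a).reverse ↔ IsCompatible r a := by
  have zipWith_ofFn : List.zipWith biletter (List.ofFn a) (List.ofFn r) =
      List.ofFn fun i => biletter (a i) (r i) :=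
    List.ext_getElem (by simp) (by simp)
  rw [IsCompatibleWord, ← List.reverse_zipWith (by simp), zipWith_ofFn, List.pairwise_reverse,
    List.pairwise_ofFn, IsCompatible, monotone_iff_forall_lt]

open Classical in
theorem card_comp_sort_eq {S : Finset (Fin n → α)} (hS : ∀ u ∈ S, ∀ σ : Equiv.Perm (Fin n),
    u ∘ σ ∈ S) {a : Fin n → α} (haS : a ∈ S) (ha : Monotone a) :
    #{u ∈ S | u ∘ Tuple.sort u = a} = #{P : TableauPair n | IsCompatible P.2.2.row a} := by
  have hset : (({u ∈ S | u ∘ Tuple.sort u = a} : Finset (Fin n → α)) : Set (Fin n → α)) =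
      {u | univ.val.map u = univ.val.map a} := by
    ext u
    simp only [coe_filter, Set.mem_ofPred_eq, ← comp_sort_eq_iff ha, and_iff_right_iff_imp]
    rintro rfl
    simpa [Function.comp_assoc] using hS _ haS (Tuple.sort u)⁻¹
  calc #{u ∈ S | u ∘ Tuple.sort u = a}
      = (univ.val.map a).countPerms := by
        rw [← Set.ncard_coe_finset, hset, ncard_map_univ_eq_countPerms (by simp)]
    _ = latticePairCount (List.ofFn a).reverse := by
        rw [latticePairCount_eq_countPerms, Multiset.coe_reverse, Fin.univ_val_map]
        exact List.pairwise_reverse.2 ha.sortedLE_ofFn.pairwise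
    _ = #{P : TableauPair n | IsCompatible P.2.2.row a} := by
        rw [← TableauPair.card_isCompatibleWord (n := n) (by simp)]
        simp only [StdTableau.rowWord, isCompatibleWord_reverse_ofFn]

open Classical in
/-- The Robinson–Schensted–Knuth correspondence, as an identity of cardinalities. -/
theorem card_eq_sum_card_isCompatible {S : Finset (Fin n → α)}
    (hS : ∀ u ∈ S, ∀ σ : Equiv.Perm (Fin n), u ∘ σ ∈ S) :
    #S = ∑ P : TableauPair n, #{a ∈ S | IsCompatible P.2.2.row a} := by
  calc #S
      = ∑ a ∈ S with Monotone a, #{u ∈ S | u ∘ Tuple.sort u = a} :=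
        card_eq_sum_card_fiberwise fun u hu =>
          mem_filter.2 ⟨hS u hu _, Tuple.monotone_sort u⟩
    _ = ∑ a ∈ S with Monotone a, #{P : TableauPair n | IsCompatible P.2.2.row a} :=
        sum_congr rfl fun a ha => card_comp_sort_eq hS (mem_filter.1 ha).1 (mem_filter.1 ha).2
    _ = ∑ P : TableauPair n, #{a ∈ {a ∈ S | Monotone a} | IsCompatible P.2.2.row a} :=
        sum_card_bipartiteAbove_eq_sum_card_bipartiteBelow _
    _ = ∑ P : TableauPair n, #{a ∈ S | IsCompatible P.2.2.row a} := by
        refine sum_congr rfl fun P _ => congrArg card ?_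
        rw [filter_filter]
        exact filter_congr fun a _ => and_iff_right_of_imp IsCompatible.monotone

end RobinsonSchenstedKnuth

section SignedWords

variable {ι : Type*} [Fintype ι]

/-- The bidegree of a word of signed letters, where a letter `z` stands for `t ^ z` if `0 ≤ z` and
for `q ^ (-z)` if `z ≤ 0`. -/
noncomputable def signedBidegree (u : ι → ℤ) : Fin 2 →₀ ℕ :=
  ∑ i, (Finsupp.single 0 (u i).toNat + Finsupp.single 1 (-u i).toNat)

theorem signedBidegree_zero (u : ι → ℤ) : signedBidegree u 0 = ∑ i, (u i).toNat := by
  simp [signedBidegree, Finsupp.finsetSum_apply]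

theorem signedBidegree_one (u : ι → ℤ) : signedBidegree u 1 = ∑ i, (-u i).toNat := by
  simp [signedBidegree, Finsupp.finsetSum_apply]

theorem signedBidegree_comp_equiv {κ : Type*} [Fintype κ] (u : ι → ℤ) (σ : κ ≃ ι) :
    signedBidegree (u ∘ σ) = signedBidegree u :=
  Equiv.sum_comp σ fun i => Finsupp.single 0 (u i).toNat + Finsupp.single 1 (-u i).toNat

theorem finite_signedBidegree_eq (d : Fin 2 →₀ ℕ) : {u : ι → ℤ | signedBidegree u = d}.Finite := by
  refine (Set.Finite.pi' fun _ => Set.finite_Icc (-(d 1 : ℤ)) (d 0)).subset ?_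
  rintro u rfl i
  rw [signedBidegree_zero, signedBidegree_one]
  have hpos := single_le_sum (fun j _ => (u j).toNat.zero_le) (mem_univ i)
  have hneg := single_le_sum (fun j _ => (-u j).toNat.zero_le) (mem_univ i)
  rw [Set.mem_Icc]
  omega

/-- At most `N₁` letters of `u` are positive and at most `N₂` are negative. -/
def IsBalanced (N₁ N₂ : ℕ) (u : ι → ℤ) : Prop :=
  #{i | 0 < u i} ≤ N₁ ∧ #{i | u i < 0} ≤ N₂

variable {N₁ N₂ : ℕ}

theorem isBalanced_comp_perm {u : ι → ℤ} {σ : Equiv.Perm ι} :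
    IsBalanced N₁ N₂ (u ∘ σ) ↔ IsBalanced N₁ N₂ u := by
  have card_comp (p : ℤ → Prop) [DecidablePred p] : #{i | p ((u ∘ σ) i)} = #{i | p (u i)} :=
    card_equiv σ (by simp)
  rw [IsBalanced, IsBalanced, card_comp (0 < ·), card_comp (· < 0)]

theorem isBalanced_iff_of_monotone {a : Fin (N₂ + N₁ + 1) → ℤ} (ha : Monotone a) :
    IsBalanced N₁ N₂ a ↔ a ⟨N₂, by omega⟩ = 0 := by
  have hneg := Tuple.lt_card_lt_iff_apply_lt_of_monotone (j := ⟨N₂, by omega⟩) (a := 0) ha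
  have hpos := Tuple.lt_card_le_iff_apply_le_of_monotone (j := ⟨N₂, by omega⟩) (a := 0) ha
  have hcard := card_filter_add_card_filter_not (s := univ) (fun i => a i ≤ 0)
  simp only [not_le, card_univ, Fintype.card_fin] at hneg hpos hcard
  rw [IsBalanced]
  omega

open Classical in
theorem ncard_isBalanced (N₁ N₂ : ℕ) (d : Fin 2 →₀ ℕ) :
    {u : Fin (N₂ + N₁ + 1) → ℤ | signedBidegree u = d ∧ IsBalanced N₁ N₂ u}.ncard =
      ∑ P : TableauPair (N₂ + N₁ + 1), {a : Fin (N₂ + N₁ + 1) → ℤ | signedBidegree a = d ∧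
        a ⟨N₂, by omega⟩ = 0 ∧ IsCompatible P.2.2.row a}.ncard := by
  have hfin : {u : Fin (N₂ + N₁ + 1) → ℤ | signedBidegree u = d ∧ IsBalanced N₁ N₂ u}.Finite :=
    (finite_signedBidegree_eq d).subset fun _ h => h.1
  rw [Set.ncard_eq_toFinset_card _ hfin, card_eq_sum_card_isCompatible]
  · refine sum_congr rfl fun P _ => ?_
    rw [← Set.ncard_coe_finset]
    congr 1
    ext a
    simp only [coe_filter, Set.Finite.mem_toFinset, Set.mem_ofPred_eq, and_assoc]
    refine and_congr_right fun _ => and_congr_left fun h => isBalanced_iff_of_monotone h.monotone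
  · intro u hu σ
    simpa only [Set.Finite.mem_toFinset, Set.mem_ofPred_eq, signedBidegree_comp_equiv,
      isBalanced_comp_perm] using hu

end SignedWords

section GeometricSeries

variable {k : Type*} [Field k] {σ ι : Type*}

open Classical in
theorem coeff_inv_one_sub_monomial {w : σ →₀ ℕ} (hw : w ≠ 0) (d : σ →₀ ℕ) :
    MvPowerSeries.coeff d (1 - MvPowerSeries.monomial w (1 : k))⁻¹ =
      if ∃ c : ℕ, c • w = d then 1 else 0 := by
  let geom : MvPowerSeries σ k := fun d => if ∃ c : ℕ, c • w = d then 1 else 0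
  have coeff_geom (d) : MvPowerSeries.coeff d geom = if ∃ c : ℕ, c • w = d then 1 else 0 := rfl
  suffices geom = (1 - MvPowerSeries.monomial w 1)⁻¹ by rw [← this, coeff_geom]
  have constantCoeff_ne_zero :
      MvPowerSeries.constantCoeff (1 - MvPowerSeries.monomial w (1 : k)) ≠ 0 := by
    rw [← MvPowerSeries.coeff_zero_eq_constantCoeff_apply, map_sub, MvPowerSeries.coeff_zero_one,
      MvPowerSeries.coeff_monomial_ne hw.symm, sub_zero]
    exact one_ne_zero
  rw [MvPowerSeries.eq_inv_iff_mul_eq_one constantCoeff_ne_zero]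
  ext d
  rw [mul_sub, mul_one, map_sub, MvPowerSeries.coeff_mul_monomial, mul_one, coeff_geom, coeff_geom,
    MvPowerSeries.coeff_one]
  by_cases hd : w ≤ d
  · have hd0 : d ≠ 0 := by
      rintro rfl
      exact hw (nonpos_iff_eq_zero.1 hd)
    have shift : (∃ c : ℕ, c • w = d - w) ↔ ∃ c : ℕ, c • w = d := by
      constructor
      · rintro ⟨c, hc⟩
        exact ⟨c + 1, by rw [add_smul, one_smul, hc, tsub_add_cancel_of_le hd]⟩
      · rintro ⟨c, rfl⟩
        obtain ⟨c, rfl⟩ := Nat.exists_eq_succ_of_ne_zero (left_ne_zero_of_smul hd0)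
        exact ⟨c, by rw [Nat.succ_eq_add_one, add_smul, one_smul, add_tsub_cancel_right]⟩
    simp only [hd, if_true, shift, sub_self, hd0, if_false]
  · have multiple : (∃ c : ℕ, c • w = d) ↔ d = 0 := by
      constructor
      · rintro ⟨c, rfl⟩
        rcases Nat.eq_zero_or_pos c with rfl | hc
        · exact zero_smul _ _
        · exact absurd (le_smul_of_one_le_left zero_le hc) hd
      · rintro rfl
        exact ⟨0, zero_smul _ _⟩
    simp only [hd, if_false, multiple, sub_zero]

theorem inv_prod_mvPowerSeries (s : Finset ι) (f : ι → MvPowerSeries σ k) :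
    (∏ j ∈ s, f j)⁻¹ = ∏ j ∈ s, (f j)⁻¹ := by
  induction s using Finset.cons_induction with
  | empty => rw [prod_empty, prod_empty, MvPowerSeries.inv_eq_iff_mul_eq_one (by simp), one_mul]
  | cons j s hj ih => rw [prod_cons, prod_cons, MvPowerSeries.mul_inv_rev, ih, mul_comm]

variable [Fintype ι]

theorem coeff_inv_prod_one_sub_monomial {W : ι → σ →₀ ℕ} (hW : ∀ j, W j ≠ 0) (d : σ →₀ ℕ) :
    MvPowerSeries.coeff d (∏ j, (1 - MvPowerSeries.monomial (W j) (1 : k)))⁻¹ =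
      ({c : ι → ℕ | ∑ j, c j • W j = d}.ncard : k) := by
  classical
  rw [inv_prod_mvPowerSeries, MvPowerSeries.coeff_prod]
  simp only [coeff_inv_one_sub_monomial (hW _), prod_boole, mem_univ, true_imp_iff, sum_boole]
  rw [← Set.ncard_coe_finset]
  congr 1
  symm
  refine Set.ncard_congr (fun c _ => Finsupp.equivFunOnFinite.symm fun j => c j • W j) ?_ ?_ ?_
  · intro c hc
    simpa [mem_finsuppAntidiag] using hc
  · intro c c' _ _ h
    funext j
    obtain ⟨x, hx⟩ := Finsupp.ne_iff.1 (hW j)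
    exact mul_right_cancel₀ hx (DFunLike.congr_fun (DFunLike.congr_fun h j) x)
  · intro l hl
    obtain ⟨hl, hmul⟩ := mem_filter.1 (mem_coe.1 hl)
    choose c hc using hmul
    refine ⟨c, ?_, Finsupp.ext hc⟩
    simp only [Set.mem_ofPred_eq, hc]
    exact (mem_finsuppAntidiag.1 hl).1

theorem coeff_monomial_mul_inv_prod {W : ι → σ →₀ ℕ} (hW : ∀ j, W j ≠ 0) (e : ι → ℕ)
    (d : σ →₀ ℕ) :
    MvPowerSeries.coeff d (MvPowerSeries.monomial (∑ j, e j • W j) (1 : k) *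
        (∏ j, (1 - MvPowerSeries.monomial (W j) (1 : k)))⁻¹) =
      ({c : ι → ℕ | ∑ j, (c + e) j • W j = d}.ncard : k) := by
  simp only [MvPowerSeries.coeff_monomial_mul, Pi.add_apply, add_smul, sum_add_distrib]
  split_ifs with h
  · simp only [one_mul, coeff_inv_prod_one_sub_monomial hW, eq_tsub_iff_add_eq_of_le h]
  · have : {c : ι → ℕ | ∑ j, c j • W j + ∑ j, e j • W j = d} = ∅ :=
      Set.eq_empty_of_forall_notMem fun c hc => h (le_of_add_le_right hc.le)
    rw [this, Set.ncard_empty, Nat.cast_zero]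

end GeometricSeries

section CenteredSums

variable {N : ℕ}

/-- The sequence with differences `e` that vanishes at `k`. -/
def centeredSum (k : Fin (N + 1)) (e : Fin N → ℕ) (i : Fin (N + 1)) : ℤ :=
  (∑ j with k ≤ j.castSucc ∧ j.castSucc < i, e j : ℕ) -
    (∑ j with i ≤ j.castSucc ∧ j.castSucc < k, e j : ℕ)

variable {k : Fin (N + 1)} {e : Fin N → ℕ}

theorem centeredSum_of_le {i : Fin (N + 1)} (h : k ≤ i) :
    centeredSum k e i = (∑ j with k ≤ j.castSucc ∧ j.castSucc < i, e j : ℕ) := by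
  rw [centeredSum, filter_false_of_mem (p := fun j : Fin N => i ≤ j.castSucc ∧ j.castSucc < k)
    fun j _ hj => (h.trans hj.1).not_gt hj.2, sum_empty, Nat.cast_zero, sub_zero]

theorem centeredSum_of_ge {i : Fin (N + 1)} (h : i ≤ k) :
    centeredSum k e i = -(∑ j with i ≤ j.castSucc ∧ j.castSucc < k, e j : ℕ) := by
  rw [centeredSum, filter_false_of_mem (p := fun j : Fin N => k ≤ j.castSucc ∧ j.castSucc < i)
    fun j _ hj => (h.trans hj.1).not_gt hj.2, sum_empty, Nat.cast_zero, zero_sub]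

theorem centeredSum_self : centeredSum k e k = 0 := by rw [centeredSum, sub_self]

theorem toNat_centeredSum (i : Fin (N + 1)) :
    (centeredSum k e i).toNat = ∑ j with k ≤ j.castSucc ∧ j.castSucc < i, e j := by
  rcases le_total k i with h | h
  · rw [centeredSum_of_le h, Int.toNat_natCast]
  · rw [centeredSum_of_ge h, Int.toNat_neg_natCast, filter_false_of_mem
      fun j _ hj => (h.trans hj.1).not_gt hj.2, sum_empty]

theorem toNat_neg_centeredSum (i : Fin (N + 1)) :
    (-centeredSum k e i).toNat = ∑ j with i ≤ j.castSucc ∧ j.castSucc < k, e j := by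
  rcases le_total k i with h | h
  · rw [centeredSum_of_le h, Int.toNat_neg_natCast, filter_false_of_mem
      fun j _ hj => (h.trans hj.1).not_gt hj.2, sum_empty]
  · rw [centeredSum_of_ge h, neg_neg, Int.toNat_natCast]

theorem centeredSum_succ (j : Fin N) :
    centeredSum k e j.succ = centeredSum k e j.castSucc + e j := by
  have h : (e j : ℤ) = ∑ l, if l = j then (e l : ℤ) else 0 := by simp
  simp only [centeredSum, h, Nat.cast_sum, sum_filter, ← sum_sub_distrib, ← sum_add_distrib]
  refine sum_congr rfl fun l _ => ?_
  simp only [Fin.le_def, Fin.lt_def, Fin.ext_iff, Fin.val_succ, Fin.val_castSucc]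
  split_ifs <;> omega

theorem eq_centeredSum {a : Fin (N + 1) → ℤ} (hk : a k = 0)
    (h : ∀ j : Fin N, a j.succ = a j.castSucc + e j) : a = centeredSum k e := by
  have sub_eq (i : Fin (N + 1)) : a i - centeredSum k e i = a 0 - centeredSum k e 0 := by
    induction i using Fin.induction with
    | zero => rfl
    | succ j ih => rw [h, centeredSum_succ, add_sub_add_right_eq_sub, ih]
  funext i
  rw [← sub_eq_zero, sub_eq, ← sub_eq k, hk, centeredSum_self, sub_self]

theorem centeredSum_injective : Function.Injective (centeredSum (N := N) k) := fun e e' h => by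
  funext j
  have := centeredSum_succ (k := k) (e := e) j
  rw [h, centeredSum_succ] at this
  omega

theorem signedBidegree_centeredSum_zero :
    signedBidegree (centeredSum k e) 0 = ∑ j with k ≤ j.castSucc, e j * (N - j) := by
  have card_later (j : Fin N) : #{i : Fin (N + 1) | j.castSucc < i} = N - j := by
    simp [filter_lt_eq_Ioi]
  simp only [signedBidegree_zero, toNat_centeredSum]
  rw [sum_comm' (t' := {j | k ≤ j.castSucc}) (s' := fun j => {i | j.castSucc < i})
    (by simp [and_comm])]
  simp only [sum_const, card_later, smul_eq_mul, mul_comm]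

theorem signedBidegree_centeredSum_one :
    signedBidegree (centeredSum k e) 1 = ∑ j with j.castSucc < k, e j * (j + 1) := by
  have card_earlier (j : Fin N) : #{i : Fin (N + 1) | i ≤ j.castSucc} = j + 1 := by
    simp [filter_ge_eq_Iic]
  simp only [signedBidegree_one, toNat_neg_centeredSum]
  rw [sum_comm' (t' := {j | j.castSucc < k}) (s' := fun j => {i | i ≤ j.castSucc}) (by simp)]
  simp only [sum_const, card_earlier, smul_eq_mul, mul_comm]

/-- The bidegree that a unit step at `j` adds to a sequence vanishing at `N₂`: all later letters
become more positive, or all earlier ones more negative. -/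
noncomputable def stepWeight (N₁ N₂ : ℕ) : Fin (N₂ + N₁) → Fin 2 →₀ ℕ :=
  Fin.append (fun j => Finsupp.single 1 (j + 1)) (fun j => Finsupp.single 0 (N₁ - j))

theorem stepWeight_ne_zero (N₁ N₂ : ℕ) (j : Fin (N₂ + N₁)) : stepWeight N₁ N₂ j ≠ 0 := by
  cases j using Fin.addCases with
  | left j => simp [stepWeight]
  | right j => simp [stepWeight, -Finsupp.single_tsub, Nat.sub_eq_zero_iff_le]

theorem signedBidegree_centeredSum {N₁ N₂ : ℕ} (e : Fin (N₂ + N₁) → ℕ) :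
    signedBidegree (centeredSum ⟨N₂, by omega⟩ e) = ∑ j, e j • stepWeight N₁ N₂ j := by
  ext x
  rw [Finsupp.finsetSum_apply]
  match x with
  | 0 =>
    rw [signedBidegree_centeredSum_zero, sum_filter, Fin.sum_univ_add, Fin.sum_univ_add]
    simp [stepWeight, Fin.le_def, Nat.add_sub_add_left, fun i : Fin N₂ => i.isLt.not_ge]
  | 1 =>
    rw [signedBidegree_centeredSum_one, sum_filter, Fin.sum_univ_add, Fin.sum_univ_add]
    simp [stepWeight, Fin.lt_def, mul_add_one]

theorem prod_one_sub_stepWeight (N₁ N₂ : ℕ) :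
    ∏ j, (1 - MvPowerSeries.monomial (stepWeight N₁ N₂ j) (1 : ℚ)) =
      risingProd (MvPowerSeries.X 1) N₂ * risingProd (MvPowerSeries.X 0) N₁ := by
  simp only [Fin.prod_univ_add, stepWeight, Fin.append_left, Fin.append_right,
    ← MvPowerSeries.X_pow_eq, risingProd, prod_range]
  congr 1
  rw [← Equiv.prod_comp Fin.revPerm]
  refine prod_congr rfl fun j _ => ?_
  rw [Fin.revPerm_apply, Fin.val_rev, Nat.sub_sub_self j.isLt]

end CenteredSums

section CompatibleSequences

variable {N : ℕ}

/-- The least differences of an integer sequence compatible with the row indices `r`. -/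
def ascentStep (r : Fin (N + 1) → ℕ) (j : Fin N) : ℕ :=
  if r j.castSucc < r j.succ then 1 else 0

variable {r : Fin (N + 1) → ℕ}

theorem isCompatible_iff_add_ascentStep_le {a : Fin (N + 1) → ℤ} :
    IsCompatible r a ↔ ∀ j : Fin N, a j.castSucc + ascentStep r j ≤ a j.succ := by
  rw [IsCompatible, Fin.monotone_iff_le_succ]
  refine forall_congr' fun j => ?_
  rw [biletter_le_biletter, ascentStep]
  split_ifs <;> push_cast <;> omega

theorem isCompatible_centeredSum (k : Fin (N + 1)) (c : Fin N → ℕ) :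
    IsCompatible r (centeredSum k (c + ascentStep r)) := by
  rw [isCompatible_iff_add_ascentStep_le]
  intro j
  rw [centeredSum_succ, Pi.add_apply]
  omega

theorem IsCompatible.exists_eq_centeredSum {a : Fin (N + 1) → ℤ} {k : Fin (N + 1)}
    (ha : IsCompatible r a) (hk : a k = 0) :
    ∃ c : Fin N → ℕ, centeredSum k (c + ascentStep r) = a := by
  rw [isCompatible_iff_add_ascentStep_le] at ha
  refine ⟨fun j => (a j.succ - a j.castSucc - ascentStep r j).toNat,
    (eq_centeredSum hk fun j => ?_).symm⟩
  have := ha j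
  rw [Pi.add_apply]
  omega

theorem ncard_isCompatible {N₁ N₂ : ℕ} (r : Fin (N₂ + N₁ + 1) → ℕ) (d : Fin 2 →₀ ℕ) :
    ({a : Fin (N₂ + N₁ + 1) → ℤ | signedBidegree a = d ∧
        a ⟨N₂, by omega⟩ = 0 ∧ IsCompatible r a}.ncard : ℚ) =
      MvPowerSeries.coeff d (MvPowerSeries.monomial
        (signedBidegree (centeredSum ⟨N₂, by omega⟩ (ascentStep r))) 1 *
          (risingProd (MvPowerSeries.X 1) N₂ * risingProd (MvPowerSeries.X 0) N₁)⁻¹) := by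
  have image : {a : Fin (N₂ + N₁ + 1) → ℤ | signedBidegree a = d ∧
      a ⟨N₂, by omega⟩ = 0 ∧ IsCompatible r a} =
      (fun c => centeredSum ⟨N₂, by omega⟩ (c + ascentStep r)) ''
        {c | ∑ j, (c + ascentStep r) j • stepWeight N₁ N₂ j = d} := by
    ext a
    constructor
    · rintro ⟨hd, h0, hr⟩
      obtain ⟨c, rfl⟩ := hr.exists_eq_centeredSum h0
      exact ⟨c, (signedBidegree_centeredSum _).symm.trans hd, rfl⟩
    · rintro ⟨c, hc, rfl⟩
      exact ⟨(signedBidegree_centeredSum _).trans hc, centeredSum_self,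
        isCompatible_centeredSum _ c⟩
  rw [← prod_one_sub_stepWeight, signedBidegree_centeredSum,
    coeff_monomial_mul_inv_prod (stepWeight_ne_zero N₁ N₂), image, Set.ncard_image_of_injective]
  exact centeredSum_injective.comp (add_left_injective (ascentStep r))

end CompatibleSequences

section CochargeSeries

namespace StdTableau

variable {μ : YoungDiagram} {n : ℕ}

/-- The cocharge of the numbers of a tableau, normalized to vanish at the number `k + 1`. -/
def signedCocharge (T : StdTableau μ n) (k i : Fin n) : ℤ :=
  (T.cocharge i i.isLt : ℤ) - T.cocharge k k.isLt

theorem cocharge_succ {N : ℕ} (T : StdTableau μ (N + 1)) (j : Fin N) :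
    T.cocharge j.succ j.succ.isLt =
      T.cocharge j.castSucc j.castSucc.isLt + ascentStep T.row j := by
  have col_le (h : T.row j.succ ≤ T.row j.castSucc) : T.col j.castSucc ≤ T.col j.succ := by
    by_contra! hcol
    exact (T.le_of_row_le_of_col_le h hcol.le).not_gt j.castSucc_lt_succ
  change T.cocharge (j + 1) _ = _
  rw [cocharge, ascentStep]
  change (if T.row j.succ ≤ T.row j.castSucc ∧ T.col j.castSucc ≤ T.col j.succ then
    T.cocharge j _ else T.cocharge j _ + 1) = T.cocharge j _ + _
  simp only [and_iff_left_of_imp col_le]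
  split_ifs <;> omega

theorem signedCocharge_eq_centeredSum {N : ℕ} (T : StdTableau μ (N + 1)) (k : Fin (N + 1)) :
    T.signedCocharge k = centeredSum k (ascentStep T.row) := by
  refine eq_centeredSum (sub_self _) fun j => ?_
  rw [signedCocharge, signedCocharge, T.cocharge_succ, Nat.cast_add, add_sub_right_comm]

theorem isCompatible_signedCocharge (T : StdTableau μ n) (k : Fin n) :
    IsCompatible T.row (T.signedCocharge k) := by
  cases n with
  | zero => exact k.elim0
  | succ N => simpa [signedCocharge_eq_centeredSum] using isCompatible_centeredSum k 0

end StdTableau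

theorem series_eq_of_coeff_eq_ncard_isBalanced {n N₁ N₂ : ℕ} (hn : n = N₂ + N₁ + 1)
    {H : MvPowerSeries (Fin 2) ℚ}
    (hH : ∀ d, MvPowerSeries.coeff d H =
      ({u : Fin n → ℤ | signedBidegree u = d ∧ IsBalanced N₁ N₂ u}.ncard : ℚ)) :
    H = (risingProd (MvPowerSeries.X 0) N₁)⁻¹ * (risingProd (MvPowerSeries.X 1) N₂)⁻¹ *
      ∑ P : TableauPair n, MvPowerSeries.monomial
        (signedBidegree (P.2.2.signedCocharge ⟨N₂, by omega⟩)) 1 := by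
  subst hn
  rw [← MvPowerSeries.mul_inv_rev, mul_comm, sum_mul]
  ext d
  simp only [hH, ncard_isBalanced, Nat.cast_sum, ncard_isCompatible, map_sum,
    StdTableau.signedCocharge_eq_centeredSum]

end CochargeSeries

section MonomialIdeals

variable {R : Type*} [CommRing R] {σ : Type*}

theorem restrictSupport_union (A B : Set (σ →₀ ℕ)) :
    restrictSupport R (A ∪ B) = restrictSupport R A ⊔ restrictSupport R B := by
  simp only [restrictSupport_eq_span, Set.image_union, Submodule.span_union]

theorem disjoint_restrictSupport {A B : Set (σ →₀ ℕ)} (h : Disjoint A B) :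
    Disjoint (restrictSupport R A) (restrictSupport R B) := by
  rw [Submodule.disjoint_def]
  intro p hA hB
  rw [mem_restrictSupport_iff] at hA hB
  exact support_eq_empty.1 (coe_eq_empty.1 (Set.subset_empty_iff.1 (h hA hB)))

theorem finrank_map_restrictSupport [Nontrivial R] {I : Ideal (MvPolynomial σ R)}
    {B : Set (σ →₀ ℕ)} (hI : I.restrictScalars R = restrictSupport R B) (A : Set (σ →₀ ℕ)) :
    Module.finrank R ((restrictSupport R A).map (Ideal.Quotient.mkₐ R I).toLinearMap) =
      (A \ B).ncard := by
  set mk := (Ideal.Quotient.mkₐ R I).toLinearMap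
  have ker_mk : LinearMap.ker mk = restrictSupport R B := by
    rw [← hI]
    ext p
    exact Ideal.Quotient.eq_zero_iff_mem
  have map_inter : (restrictSupport R (A ∩ B)).map mk = ⊥ := by
    rw [eq_bot_iff, Submodule.map_le_iff_le_comap, Submodule.comap_bot, ker_mk]
    exact restrictSupport_mono R Set.inter_subset_right
  have injective_mk : Function.Injective (mk.domRestrict (restrictSupport R (A \ B))) := by
    rw [LinearMap.injective_domRestrict_iff, ker_mk]
    exact disjoint_restrictSupport Set.disjoint_sdiff_left
  calc Module.finrank R ((restrictSupport R A).map mk)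
      = Module.finrank R ((restrictSupport R (A \ B)).map mk) := by
        rw [← Set.sdiff_union_inter A B, restrictSupport_union, Submodule.map_sup, map_inter,
          sup_bot_eq, Set.sdiff_union_inter]
    _ = Module.finrank R (restrictSupport R (A \ B)) := by
        rw [← LinearMap.range_domRestrict, LinearMap.finrank_range_of_inj injective_mk]
    _ = (A \ B).ncard := Module.finrank_eq_nat_card_basis (basisRestrictSupport R (A \ B))

theorem sum_single_one_le_iff {F : Finset σ} {e : σ →₀ ℕ} :
    ∑ x ∈ F, Finsupp.single x 1 ≤ e ↔ F ⊆ e.support := by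
  classical
  have apply_eq (x : σ) : (∑ y ∈ F, Finsupp.single y 1) x = if x ∈ F then 1 else 0 := by
    simp [Finsupp.finsetSum_apply, Finsupp.single_apply]
  simp only [Finsupp.le_def, apply_eq, subset_iff, Finsupp.mem_support_iff,
    ← Nat.one_le_iff_ne_zero]
  refine forall_congr' fun x => ?_
  split_ifs with h <;> simp [h]

theorem restrictScalars_span_prod_X (𝓕 : Set (Finset σ)) :
    (Ideal.span ((fun F => ∏ x ∈ F, X x) '' 𝓕) : Ideal (MvPolynomial σ R)).restrictScalars R =
      restrictSupport R {e | ∃ F ∈ 𝓕, F ⊆ e.support} := by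
  have prod_X (F : Finset σ) :
      (∏ x ∈ F, X x : MvPolynomial σ R) = monomial (∑ x ∈ F, Finsupp.single x 1) 1 :=
    (monomial_sum_one F _).symm
  simp only [prod_X, ← Set.image_image (fun e => monomial e (1 : R)) 
    (fun F => ∑ x ∈ F, Finsupp.single x 1)]
  ext p
  rw [Submodule.restrictScalars_mem, mem_ideal_span_monomial_image, mem_restrictSupport_iff]
  simp [Set.subset_def, sum_single_one_le_iff]

end MonomialIdeals

section HollowIdeal

/-- The exponent of the monomial `∏ᵢ zᵢ ^ (uᵢ)` of a word `u` of signed letters, where a letter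
`a ≥ 0` gives the factor `xᵢ ^ a` and a letter `a ≤ 0` gives `yᵢ ^ (-a)`. -/
noncomputable def signedExponent {n : ℕ} (u : Fin n → ℤ) : Fin n ⊕ Fin n →₀ ℕ :=
  Finsupp.equivFunOnFinite.symm (Sum.elim (fun i => (u i).toNat) fun i => (-u i).toNat)

variable {n : ℕ}

@[simp]
theorem signedExponent_inl (u : Fin n → ℤ) (i : Fin n) :
    signedExponent u (Sum.inl i) = (u i).toNat := rfl

@[simp]
theorem signedExponent_inr (u : Fin n → ℤ) (i : Fin n) :
    signedExponent u (Sum.inr i) = (-u i).toNat := rfl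

theorem signedExponent_injective : Function.Injective (signedExponent (n := n)) := fun u v h => by
  funext i
  have hpos := DFunLike.congr_fun h (Sum.inl i)
  have hneg := DFunLike.congr_fun h (Sum.inr i)
  rw [signedExponent_inl, signedExponent_inl] at hpos
  rw [signedExponent_inr, signedExponent_inr] at hneg
  omega

theorem exists_signedExponent_eq {e : Fin n ⊕ Fin n →₀ ℕ}
    (he : ∀ i, e (Sum.inl i) = 0 ∨ e (Sum.inr i) = 0) : ∃ u, signedExponent u = e := by
  refine ⟨fun i => e (Sum.inl i) - e (Sum.inr i), ?_⟩
  ext (i | i)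
  · have := he i
    rw [signedExponent_inl]
    omega
  · have := he i
    rw [signedExponent_inr]
    omega

theorem weight_signedExponent (u : Fin n → ℤ) :
    Finsupp.weight (Sum.elim (fun _ => ((1, 0) : ℕ × ℕ)) fun _ => ((0, 1) : ℕ × ℕ))
      (signedExponent u) = (signedBidegree u 0, signedBidegree u 1) := by
  rw [Finsupp.weight_apply, Finsupp.sum_fintype _ _ (by simp), Fintype.sum_sum_type,
    signedBidegree_zero, signedBidegree_one]
  ext <;> simp [Prod.fst_sum, Prod.snd_sum]

/-- The sets of variables whose products are the generators of the ideal `hollowG`. -/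
def hollowNonfaces (n N₁ N₂ : ℕ) : Set (Finset (Fin n ⊕ Fin n)) :=
  Set.range (fun i => {Sum.inl i, Sum.inr i}) ∪ {F | ∃ D : Finset (Fin n), #D = N₁ + 1 ∧
    F = D.map .inl} ∪ {F | ∃ D : Finset (Fin n), #D = N₂ + 1 ∧ F = D.map .inr}

theorem hollowG_eq_span (γ : HollowParam) : hollowG γ = Ideal.span
    ((fun F => ∏ x ∈ F, X x) '' hollowNonfaces γ.n (γ.m₁ + γ.p₁) (γ.m₂ + γ.p₂)) := by
  rw [hollowG, hollowNonfaces, Set.image_union, Set.image_union, ← Set.range_comp]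
  congr 4
  · funext i
    simp
  · ext f
    simp [eq_comm]
  · ext f
    simp [eq_comm]

theorem exists_hollowNonfaces_subset_iff {N₁ N₂ : ℕ} {S : Finset (Fin n ⊕ Fin n)} :
    (∃ F ∈ hollowNonfaces n N₁ N₂, F ⊆ S) ↔
      (∃ i, Sum.inl i ∈ S ∧ Sum.inr i ∈ S) ∨ N₁ < #S.toLeft ∨ N₂ < #S.toRight := by
  simp only [← Nat.succ_le_iff, le_card_iff_exists_subset_card, ← map_inl_subset_iff_subset_toLeft,
    ← map_inr_subset_iff_subset_toRight, hollowNonfaces, Set.mem_union, or_and_right, exists_or,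
    Set.exists_range_iff, insert_subset_iff, singleton_subset_iff, Set.mem_ofPred_eq, or_assoc]
  simp [and_comm]

theorem toLeft_support_signedExponent (u : Fin n → ℤ) :
    (signedExponent u).support.toLeft = ({i | 0 < u i} : Finset (Fin n)) := by
  ext i
  simp [Finsupp.mem_support_iff]

theorem toRight_support_signedExponent (u : Fin n → ℤ) :
    (signedExponent u).support.toRight = ({i | u i < 0} : Finset (Fin n)) := by
  ext i
  simp [Finsupp.mem_support_iff]

theorem exists_hollowNonfaces_subset_support_signedExponent_iff {N₁ N₂ : ℕ} {u : Fin n → ℤ} :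
    (∃ F ∈ hollowNonfaces n N₁ N₂, F ⊆ (signedExponent u).support) ↔ ¬ IsBalanced N₁ N₂ u := by
  have hne : ¬ ∃ i, Sum.inl i ∈ (signedExponent u).support ∧
      Sum.inr i ∈ (signedExponent u).support := by
    simp only [Finsupp.mem_support_iff, signedExponent_inl, signedExponent_inr]
    omega
  rw [exists_hollowNonfaces_subset_iff, or_iff_right hne, toLeft_support_signedExponent,
    toRight_support_signedExponent, IsBalanced, not_and_or, not_le, not_le]

theorem exists_signedExponent_eq_of_forall_hollowNonfaces {N₁ N₂ : ℕ} {e : Fin n ⊕ Fin n →₀ ℕ}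
    (he : ¬ ∃ F ∈ hollowNonfaces n N₁ N₂, F ⊆ e.support) : ∃ u, signedExponent u = e := by
  refine exists_signedExponent_eq fun i => ?_
  by_contra! hi
  exact he (exists_hollowNonfaces_subset_iff.2 (Or.inl ⟨i, by simpa using hi⟩))

theorem coeff_hilbertSeries_hollowG (γ : HollowParam) (d : Fin 2 →₀ ℕ) :
    MvPowerSeries.coeff d (hilbertSeries (hollowG γ)) =
      ({u : Fin γ.n → ℤ | signedBidegree u = d ∧
        IsBalanced (γ.m₁ + γ.p₁) (γ.m₂ + γ.p₂) u}.ncard : ℚ) := by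
  have bihomogeneous_eq : bihomogeneous γ.n (d 0) (d 1) =
      restrictSupport ℂ {e | Finsupp.weight _ e = (d 0, d 1)} :=
    weightedHomogeneousSubmodule_eq_finsupp_supported ℂ _ _
  have weight_eq_iff (u : Fin γ.n → ℤ) : Finsupp.weight (Sum.elim (fun _ => ((1, 0) : ℕ × ℕ))
      fun _ => ((0, 1) : ℕ × ℕ)) (signedExponent u) = (d 0, d 1) ↔ signedBidegree u = d := by
    rw [weight_signedExponent, Prod.mk.injEq, Finsupp.ext_iff, Fin.forall_fin_two]
  change (Module.finrank ℂ (quotientComponent (hollowG γ) (d 0) (d 1)) : ℚ) = _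
  rw [quotientComponent, bihomogeneous_eq, hollowG_eq_span,
    finrank_map_restrictSupport (restrictScalars_span_prod_X _),
    ← Set.ncard_image_of_injective _ signedExponent_injective]
  congr 2
  ext e
  constructor
  · rintro ⟨he, hF⟩
    obtain ⟨u, rfl⟩ := exists_signedExponent_eq_of_forall_hollowNonfaces hF
    exact ⟨u, ⟨(weight_eq_iff u).1 he, not_not.1
      (exists_hollowNonfaces_subset_support_signedExponent_iff.not.1 hF)⟩, rfl⟩
  · rintro ⟨u, ⟨hd, hu⟩, rfl⟩
    exact ⟨(weight_eq_iff u).2 hd,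
      exists_hollowNonfaces_subset_support_signedExponent_iff.not.2 (not_not.2 hu)⟩

end HollowIdeal

section Bipermanents

theorem eq_of_isLowerSet_range_of_lt_iff_lt {ι : Type*} {f g : ι → ℕ}
    (hf : IsLowerSet (Set.range f)) (hg : IsLowerSet (Set.range g))
    (h : ∀ i j, f i < f j ↔ g i < g j) : f = g := by
  have key {f g : ι → ℕ} (hf : IsLowerSet (Set.range f)) (h : ∀ i j, f i < f j → g i < g j) (j) :
      f j ≤ g j := by
    induction hj : f j using Nat.strong_induction_on generalizing j with
    | _ b ih =>
      refine le_of_forall_lt fun a ha => ?_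
      obtain ⟨i, rfl⟩ := hf (hj ▸ ha.le) ⟨j, rfl⟩
      exact (ih _ ha i rfl).trans_lt (h i j (hj ▸ ha))
  funext j
  exact (key hf (fun i j => (h i j).1) j).antisymm (key hg (fun i j => (h i j).2) j)

theorem IsCompatible.eq_of_comp_perm {n : ℕ} {r s : Fin n → ℕ} {a b : Fin n → ℤ}
    (ha : IsCompatible r a) (hb : IsCompatible s b) (τ : Equiv.Perm (Fin n)) (hab : b ∘ τ = a)
    (hrs : s ∘ τ = r) : r = s := by
  subst hab hrs
  have biletter_eq := Tuple.unique_monotone (f := fun i => biletter (b i) (s i)) (σ := τ) (τ := 1)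
    ha hb
  exact funext fun i => congrArg (fun p => OrderDual.ofDual (ofLex p).2) (congrFun biletter_eq i)

namespace StdTableau

variable {μ ν : YoungDiagram} {n : ℕ}

theorem isLowerSet_range_row (T : StdTableau μ n) : IsLowerSet (Set.range T.row) := by
  rintro _ a ha ⟨j, rfl⟩
  obtain ⟨i, hi, -⟩ := T.exists_row_col_eq (μ.up_left_mem ha le_rfl (T.row_col_mem j))
  exact ⟨i, hi⟩

/-- The words that list the letters of a filling `v` along the numbers of `T`, up to rearrangements
within the rows of `T`: the signed exponents of the monomials of the bipermanent. -/
def rowRearrangements (T : StdTableau μ n) (v : {c // c ∈ μ.cells} → ℤ) : Set (Fin n → ℤ) :=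
  {u | ∃ ρ : Equiv.Perm (Fin n), (∀ i, T.row (ρ i) = T.row i) ∧ v ∘ T.entry.symm ∘ ρ = u}

theorem bipermanent_ofInt (T : StdTableau μ n) (v : {c // c ∈ μ.cells} → ℤ) :
    (T.bipermanent fun c => Alphabet.ofInt (v c)) =
      ∑ σ ∈ T.rowGroup, monomial (signedExponent (v ∘ T.entry.symm ∘ σ.symm)) 1 := by
  refine sum_congr rfl fun σ _ => ?_
  rw [monomial_eq, C_1, one_mul, Finsupp.prod_fintype _ _ (by simp), Fintype.prod_sum_type,
    ← prod_mul_distrib]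
  exact prod_equiv σ (by simp) fun i _ => by simp [Alphabet.ofInt]

theorem coeff_bipermanent_ne_zero_iff {T : StdTableau μ n} {v : {c // c ∈ μ.cells} → ℤ}
    {u : Fin n → ℤ} :
    coeff (signedExponent u) (T.bipermanent fun c => Alphabet.ofInt (v c)) ≠ 0 ↔
      u ∈ T.rowRearrangements v := by
  classical
  simp only [bipermanent_ofInt, coeff_sum, coeff_monomial, signedExponent_injective.eq_iff,
    sum_boole, Nat.cast_ne_zero, card_ne_zero, Finset.Nonempty, mem_filter, rowGroup, mem_univ,
    true_and]
  have row_symm {σ : Equiv.Perm (Fin n)} (hσ : ∀ i, T.row (σ i) = T.row i) (i : Fin n) :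
      T.row (σ.symm i) = T.row i := by
    rw [← hσ, Equiv.apply_symm_apply]
  exact ⟨fun ⟨σ, hσ, h⟩ => ⟨σ.symm, row_symm hσ, h⟩, fun ⟨ρ, hρ, h⟩ => ⟨ρ.symm, row_symm hρ, h⟩⟩

theorem rowRearrangements_eq_of_bipermanent_eq {T : StdTableau μ n} {U : StdTableau ν n}
    {v : {c // c ∈ μ.cells} → ℤ} {w : {c // c ∈ ν.cells} → ℤ}
    (h : (T.bipermanent fun c => Alphabet.ofInt (v c)) =
      U.bipermanent fun c => Alphabet.ofInt (w c)) :
    T.rowRearrangements v = U.rowRearrangements w := by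
  ext u
  rw [← coeff_bipermanent_ne_zero_iff, h, coeff_bipermanent_ne_zero_iff]

/-- Semistandardness of a filling of a Young diagram by integers: the entries increase weakly along
rows and strictly along columns. -/
structure IsSemistandard (v : {c // c ∈ μ.cells} → ℤ) : Prop where
  row_le : ∀ c d, c.1.1 = d.1.1 → c.1.2 ≤ d.1.2 → v c ≤ v d
  col_lt : ∀ c d, c.1.2 = d.1.2 → c.1.1 < d.1.1 → v c < v d

/-- The first cell of the row that contains the number `i + 1`. -/
def rowHead (T : StdTableau μ n) (i : Fin n) : {c // c ∈ μ.cells} :=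
  ⟨(T.row i, 0), (YoungDiagram.mem_cells _).2 <|
    μ.up_left_mem le_rfl (T.col i).zero_le (T.row_col_mem i)⟩

variable {T : StdTableau μ n} {v : {c // c ∈ μ.cells} → ℤ}

theorem isLeast_rowRearrangements (hv : IsSemistandard v) (j : Fin n) :
    IsLeast ((fun u => u j) '' T.rowRearrangements v) (v (T.rowHead j)) := by
  constructor
  · have row_head : T.row j = T.row (T.entry (T.rowHead j)) := by simp [row, rowHead]
    exact ⟨_, ⟨Equiv.swap j (T.entry (T.rowHead j)), Equiv.apply_swap_eq_self row_head, rfl⟩,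
      by simp⟩
  · rintro _ ⟨_, ⟨ρ, hρ, rfl⟩, rfl⟩
    exact hv.row_le _ _ (hρ j).symm (Nat.zero_le _)

theorem apply_rowHead_lt_iff (hv : IsSemistandard v) {i j : Fin n} :
    v (T.rowHead i) < v (T.rowHead j) ↔ T.row i < T.row j := by
  have lt_of_row_lt (i j : Fin n) : T.row i < T.row j → v (T.rowHead i) < v (T.rowHead j) :=
    hv.col_lt (T.rowHead i) (T.rowHead j) rfl
  have eq_of_row_eq (h : T.row i = T.row j) : v (T.rowHead i) = v (T.rowHead j) := by
    simp only [rowHead, h]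
  refine ⟨fun h => ?_, lt_of_row_lt i j⟩
  contrapose! h
  exact h.eq_or_lt.elim (fun e => (eq_of_row_eq e.symm).ge) fun h => (lt_of_row_lt j i h).le

theorem row_eq_of_rowRearrangements_eq {U : StdTableau ν n} {w : {c // c ∈ ν.cells} → ℤ}
    (hv : IsSemistandard v) (hw : IsSemistandard w)
    (h : T.rowRearrangements v = U.rowRearrangements w) : T.row = U.row := by
  have apply_rowHead_eq (j : Fin n) : v (T.rowHead j) = w (U.rowHead j) :=
    (isLeast_rowRearrangements hv j).unique (h ▸ isLeast_rowRearrangements hw j)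
  refine eq_of_isLowerSet_range_of_lt_iff_lt T.isLowerSet_range_row U.isLowerSet_range_row
    fun i j => ?_
  rw [← apply_rowHead_lt_iff hv, ← apply_rowHead_lt_iff hw, apply_rowHead_eq, apply_rowHead_eq]

theorem isSemistandard_signedCocharge (U : StdTableau μ n) (k : Fin n) :
    IsSemistandard (U.signedCocharge k ∘ U.entry) where
  row_le c d hrow hcol := (U.isCompatible_signedCocharge k).monotone <|
    le_of_row_le_of_col_le (T := U) (by simp [row, hrow]) (by simp [col, hcol])
  col_lt c d hcol hrow := by
    have h := biletter_le_biletter.1 (U.isCompatible_signedCocharge k (U.col_lt c d hcol hrow).le)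
    simp only [row, Equiv.symm_apply_apply] at h
    exact h.resolve_right fun h => h.2.not_gt hrow

theorem eq_of_rowRearrangements_signedCocharge_eq {U U' : StdTableau μ n} {k : Fin n}
    (h : T.rowRearrangements (U.signedCocharge k ∘ U.entry) =
      T.rowRearrangements (U'.signedCocharge k ∘ U'.entry)) : U = U' := by
  obtain ⟨ρ, hρ, hw⟩ : U.signedCocharge k ∘ U.entry ∘ T.entry.symm ∈
      T.rowRearrangements (U'.signedCocharge k ∘ U'.entry) := h ▸ ⟨1, fun _ => rfl, rfl⟩
  refine ext_row ((U.isCompatible_signedCocharge k).eq_of_comp_perm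
    (U'.isCompatible_signedCocharge k)
    (U.entry.symm.trans (T.entry.trans (ρ.trans (T.entry.symm.trans U'.entry))))
    (funext fun i => ?_) (funext fun i => ?_))
  · simpa using congrFun hw (T.entry (U.entry.symm i))
  · simpa [row] using hρ (T.entry (U.entry.symm i))

end StdTableau

/-- The bipermanent `[T, C_γ(U)]_per` of a pair `(T, U)` of standard tableaux. -/
noncomputable def TableauPair.bipermanent (γ : HollowParam) (P : TableauPair γ.n) : PolyXY γ.n :=
  P.2.1.bipermanent (cochargeDiagram γ P.2.2)

theorem TableauPair.bipermanent_injective (γ : HollowParam) :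
    Function.Injective (TableauPair.bipermanent γ) := by
  rintro ⟨μ, T, U⟩ ⟨ν, T', U'⟩ h
  let k : Fin γ.n := ⟨γ.m₂ + γ.p₂, by unfold HollowParam.n; omega⟩
  have hwords : T.rowRearrangements (U.signedCocharge k ∘ U.entry) =
      T'.rowRearrangements (U'.signedCocharge k ∘ U'.entry) :=
    StdTableau.rowRearrangements_eq_of_bipermanent_eq h
  have hrow := StdTableau.row_eq_of_rowRearrangements_eq
    (U.isSemistandard_signedCocharge k) (U'.isSemistandard_signedCocharge k) hwords
  obtain rfl : μ = ν := youngDiagram_ext_rowLen fun i => by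
    rw [← T.prefixCount_row_eq_rowLen, hrow, T'.prefixCount_row_eq_rowLen]
  obtain rfl : T = T' := StdTableau.ext_row hrow
  rw [StdTableau.eq_of_rowRearrangements_signedCocharge_eq hwords]

theorem range_tableauPair_bipermanent (γ : HollowParam) :
    Set.range (TableauPair.bipermanent γ) = hollowB γ := by
  ext b
  constructor
  · rintro ⟨⟨μ, T, U⟩, rfl⟩
    exact ⟨μ, T, _, ⟨U, rfl⟩, rfl⟩
  · rintro ⟨μ, T, _, ⟨U, rfl⟩, rfl⟩
    exact ⟨⟨μ, T, U⟩, rfl⟩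

theorem monomial_signedBidegree {ι : Type*} [Fintype ι] (u : ι → ℤ) :
    MvPowerSeries.monomial (signedBidegree u) (1 : ℚ) =
      MvPowerSeries.X 0 ^ (∑ i, (u i).toNat) * MvPowerSeries.X 1 ^ (∑ i, (-u i).toNat) := by
  rw [MvPowerSeries.X_pow_eq, MvPowerSeries.X_pow_eq, MvPowerSeries.monomial_mul_monomial, mul_one,
    signedBidegree, sum_add_distrib, ← Finsupp.single_finsetSum, ← Finsupp.single_finsetSum]

theorem X_pow_degrees_bipermanent (γ : HollowParam) (P : TableauPair γ.n) :
    (MvPowerSeries.X 0 : MvPowerSeries (Fin 2) ℚ) ^ xDeg (P.bipermanent γ) *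
        (MvPowerSeries.X 1 : MvPowerSeries (Fin 2) ℚ) ^ yDeg (P.bipermanent γ) =
      MvPowerSeries.monomial (signedBidegree (P.2.2.signedCocharge
        ⟨γ.m₂ + γ.p₂, by unfold HollowParam.n; omega⟩)) 1 := by
  rw [monomial_signedBidegree, TableauPair.bipermanent, xDeg_bipermanent, yDeg_bipermanent,
    ← Equiv.sum_comp P.2.2.entry, ← Equiv.sum_comp P.2.2.entry]
  rfl

end Bipermanents

theorem mainTheorem9 (γ : HollowParam) :
    hilbertSeries (hollowG γ) =
      (risingProd (MvPowerSeries.X 0) (γ.m₁ + γ.p₁))⁻¹ *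
        (risingProd (MvPowerSeries.X 1) (γ.m₂ + γ.p₂))⁻¹ *
        ∑ b ∈ (hollowB_finite γ).toFinset,
          (MvPowerSeries.X 0 : MvPowerSeries (Fin 2) ℚ) ^ xDeg b *
            (MvPowerSeries.X 1 : MvPowerSeries (Fin 2) ℚ) ^ yDeg b := by
  classical
  have hB : (hollowB_finite γ).toFinset = Finset.univ.image (TableauPair.bipermanent γ) := by
    ext b
    rw [Set.Finite.mem_toFinset, ← range_tableauPair_bipermanent]
    simp
  rw [hB, Finset.sum_image (TableauPair.bipermanent_injective γ).injOn,
    Finset.sum_congr rfl fun P _ => X_pow_degrees_bipermanent γ P]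
  exact series_eq_of_coeff_eq_ncard_isBalanced (by unfold HollowParam.n; omega)
    (coeff_hilbertSeries_hollowG γ)
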